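/- Let $a,N$ be integers with $1\le a\le N$, let $d\ge 0$ be an integer, let $c_1,\dots,c_d$ be positive integers, all different from $2$, with $c_1\ge 3$ if $d\ge 1$, and let $z_0,\dots,z_d\in\mathbb{C}$ with $|z_j|<1$ for all $j$. If $d=0$, assume in addition that $a<N$. For positive integers $s_1,\dots,s_u$ put $$t^{\star}_{N,a}(s_1,\dots,s_u)=\sum_{k_1\ge\cdots\ge k_u\ge 0}\frac{1}{(Nk_1+a)^{s_1}\cdots(Nk_u+a)^{s_u}},\qquad t^\star_{N,a}(\emptyset)=1,$$ and, with $\{2\}^{b}$ denoting the string of $b$ twos, $$D(\boldsymbol c;\boldsymbol z)=\sum_{b_0,\dots,b_d\ge 0}t^{\star}_{N,a}(\{2\}^{b_0},c_1,\{2\}^{b_1},\dots,c_d,\{2\}^{b_d})\,z_0^{2b_0}z_1^{2b_1}\cdots z_d^{2b_d}.$$ Let $\triangle(k,m)=0$ if $k=m$ and $\triangle(k,m)=1$ otherwise. For integers $k\ge -1$, $m\ge 0$ and a string $\boldsymbol s=(s_1,\dots,s_u)$ of positive integers, put $$W^{\#}_{k,m}(\boldsymbol s)=\sum_{k\ge l_1\ge\cdots\ge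 l_u\ge m}\frac{2^{\triangle(k,l_1)+\triangle(l_1,l_2)+\cdots+\triangle(l_u,m)}}{(Nl_1+a)^{s_1}\cdots(Nl_u+a)^{s_u}}$$ if $\boldsymbol s\ne\emptyset$ and $k\ge m$, and $W^{\#}_{k,m}(\boldsymbol s)=2^{\triangle(k,m)}$ otherwise. Let $\delta(0)=2$, $\delta(1)=1$, $\delta(c)=0$ for $c\ge 3$. Put $c_0=1$, $c_{d+1}=0$, $\delta_i=\delta(c_i)+\delta(c_{i+1})$ for $0\le i\le d$, and $k_{-1}=-1$; let $\{1\}^{m}$ be the string of $m$ ones (empty if $m\le 0$), $(x)_n=x(x+1)\cdots(x+n-1)$ the Pochhammer symbol, and $B$ the Beta function. Then the series defining $D(\boldsymbol c;\boldsymbol z)$ and the values $t^\star_{N,a}$ in it converge absolutely, and $$D(\boldsymbol c;\boldsymbol z)=\frac{N}{B\left(\frac aN,\frac aN\right)}\sum_{k_0\ge k_1\ge\cdots\ge k_d\ge 0}\frac{\left(\frac{2a}{N}\right)_{k_d}}{k_d!\,(Nk_d+a)}\prod_{i=0}^{d}\frac{(-1)^{k_i\delta_i}(Nk_i+a)^{\delta_i-1}}{(Nk_i+a)^2-z_i^2}\,W^{\#}_{k_{i-1},k_i}(\{1\}^{c_i-3}),$$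 where the sum on the right is the limit, as $K\to\infty$, of the finite sums over $K\ge k_0\ge k_1\ge\cdots\ge k_d\ge 0$; for $d\ge 1$ it also converges absolutely. -/

import Mathlib

open Filter Topology

namespace TStar

/-- The summand `∏ 1 / (N k_i + a) ^ s_i` of a multiple `t`-star value of level `N`. -/
noncomputable def tStarTerm (N a : ℕ) (s : List ℕ) (k : Fin s.length → ℕ) : ℝ :=
  ∏ i, 1 / ((N : ℝ) * k i + a) ^ s.get i

/-- The multiple `t`-star value `t⋆_{N,a}(s_1, …, s_u)` of level `N`: the sum over all
`k_1 ≥ ⋯ ≥ k_u ≥ 0`. For the empty index it is `1`. -/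
noncomputable def tStar (N a : ℕ) (s : List ℕ) : ℝ :=
  ∑' k : {k : Fin s.length → ℕ // Antitone k}, tStarTerm N a s k

/-- The index `({2}^{b_0}, c_1, {2}^{b_1}, …, c_d, {2}^{b_d})`; here `c j` is `c_{j+1}`. -/
def blockIndex {d : ℕ} (c : Fin d → ℕ) (b : Fin (d + 1) → ℕ) : List ℕ :=
  List.replicate (b 0) 2 ++
    (List.ofFn fun j : Fin d => c j :: List.replicate (b j.succ) 2).flatten

/-- The general term of the generating function `D(c; z)`. -/
noncomputable def genTerm (N a : ℕ) {d : ℕ} (c : Fin d → ℕ) (z : Fin (d + 1) → ℂ)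
    (b : Fin (d + 1) → ℕ) : ℂ :=
  (tStar N a (blockIndex c b) : ℂ) * ∏ j, z j ^ (2 * b j)

/-- The generating function `D(c; z)`. -/
noncomputable def genFun (N a : ℕ) {d : ℕ} (c : Fin d → ℕ) (z : Fin (d + 1) → ℂ) : ℂ :=
  ∑' b : Fin (d + 1) → ℕ, genTerm N a c z b

/-- `△(k, m)`, which is `0` if `k = m` and `1` otherwise. -/
def tri (k m : ℤ) : ℕ := if k = m then 0 else 1

/-- `δ(0) = 2`, `δ(1) = 1` and `δ(c) = 0` for `c ≥ 3` (the value at `2` is never used). -/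
def delta : ℕ → ℕ
  | 0 => 2
  | 1 => 1
  | _ => 0

/-- The nested sum over `k ≥ l_1 ≥ ⋯ ≥ l_u ≥ m` of
`2 ^ (△(k, l_1) + △(l_1, l_2) + ⋯ + △(l_u, m)) / ((N l_1 + a)^{s_1} ⋯ (N l_u + a)^{s_u})`. -/
noncomputable def nestedSum (N a : ℕ) (m : ℤ) : List ℕ → ℤ → ℝ
  | [], k => 2 ^ tri k m
  | s :: t, k => ∑ l ∈ Finset.Icc m k,
      2 ^ tri k l / ((N : ℝ) * l + a) ^ s * nestedSum N a m t l

/-- `W^#_{k,m}(s)`. -/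
noncomputable def W (N a : ℕ) (k m : ℤ) (s : List ℕ) : ℝ :=
  if s ≠ [] ∧ m ≤ k then nestedSum N a m s k else 2 ^ tri k m

/-- `c_0 = 1`, `c_1, …, c_d`, `c_{d+1} = 0`. -/
def extC {d : ℕ} (c : Fin d → ℕ) : ℕ → ℕ
  | 0 => 1
  | i + 1 => if h : i < d then c ⟨i, h⟩ else 0

/-- `δ_i = δ(c_i) + δ(c_{i+1})`. -/
def deltaI {d : ℕ} (c : Fin d → ℕ) (i : ℕ) : ℕ := delta (extC c i) + delta (extC c (i + 1))

/-- `k_{i-1}`, with `k_{-1} = -1`. -/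
def kPrev {d : ℕ} (k : Fin (d + 1) → ℕ) (i : Fin (d + 1)) : ℤ :=
  Fin.cases (motive := fun _ => ℤ) (-1) (fun j : Fin d => (k j.castSucc : ℤ)) i

/-- The summand of the nested sum over `k_0 ≥ ⋯ ≥ k_d ≥ 0`; the Pochhammer symbol
`(x)_n` is the value of `ascPochhammer` at `x`. -/
noncomputable def summand (N a : ℕ) {d : ℕ} (c : Fin d → ℕ) (z : Fin (d + 1) → ℂ)
    (k : Fin (d + 1) → ℕ) : ℂ :=
  (ascPochhammer ℂ (k (Fin.last d))).eval (2 * (a : ℂ) / N) /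
      ((k (Fin.last d)).factorial * ((N : ℂ) * k (Fin.last d) + a)) *
    ∏ i : Fin (d + 1),
      (-1 : ℂ) ^ (k i * deltaI c i) * ((N : ℂ) * k i + a) ^ ((deltaI c i : ℤ) - 1) /
        (((N : ℂ) * k i + a) ^ 2 - z i ^ 2) *
        (W N a (kPrev k i) (k i) (List.replicate (extC c i - 3) 1) : ℂ)

open Classical in
/-- The finite set of tuples `K ≥ k_0 ≥ k_1 ≥ ⋯ ≥ k_d ≥ 0`. -/
noncomputable def tuplesLE (d K : ℕ) : Finset (Fin (d + 1) → ℕ) :=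
  (Fintype.piFinset fun _ => Finset.range (K + 1)).filter fun k => Antitone k

end TStar

/-! Write `x_k = N k + a`, and let `F_n(c; z)` be the generating series of the t-star sums truncated
at `k_1 ≤ n`. Splitting off the terms with `k_1 = n` gives, for `n ≥ 1`, `(1 - z_0² / x_n²) F_n(c;
z) = F_{n-1}(c; z) + x_n^{-c_1} F_n(c_2, …; z_1, …)`, without the last term when `d = 0`. The core
is that a finite nested sum solves this recursion: the right-hand side cut at `k_0 ≤ n`, with `k_0`
weighted by `coeff N a n k_0` (`hasSum_truncTerm`). Raising `n` multiplies the weight of `k` by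
`x_{n+1}² / (x_{n+1}² - x_k²)` (`coeff_succ_left`), which produces the factor in `z_0`. Summing the
weights across an entry `c` telescopes and leaves `x_n^{2-c}` (`sum_coeff_link`); the powers of 2 in
`W^#` are exactly those the telescoping needs. When no entry is left, the alternating sum vanishes
(`sum_alternating_coeff_pochQuot`).

Now let `n → ∞`. For each `k` the weights tend to `N / B(a/N, a/N)`, and they decrease in `k`, so by
Abel summation they form a regular summation method (`tendsto_sum_coeff_mul`): the finite sums
converge to the claimed right-hand side once the nested series converges. For `d ≥ 1` it does so
absolutely, by logarithmic bounds that use `c_1 ≥ 3`; for `d = 0` it is essentially an alternating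
series, and `a < N` makes its terms tend to 0. On the left, nonnegativity turns boundedness of the
finite sums at real points into convergence of every t-star value and of `D`
(`exists_sum_tTrunc_le`), and dominated convergence finishes the proof. -/

namespace TStar

/-! ### Linear forms and partial fraction coefficients -/

/-- The linear form `N k + a`. -/
noncomputable def lin (N a k : ℕ) : ℝ := (N : ℝ) * k + a

lemma lin_succ (N a k : ℕ) : lin N a (k + 1) = lin N a k + N := by
  unfold lin; push_cast; ring

lemma lin_zero (N a : ℕ) : lin N a 0 = a := by simp [lin]

lemma le_lin {N a : ℕ} (ha : 1 ≤ a) (haN : a ≤ N) (k : ℕ) : (k : ℝ) + 1 ≤ lin N a k := by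
  have h1 : (1 : ℝ) ≤ a := by exact_mod_cast ha
  have h2 : (1 : ℝ) ≤ N := by exact_mod_cast ha.trans haN
  have h3 : (0 : ℝ) ≤ k := k.cast_nonneg
  unfold lin; nlinarith

lemma one_le_lin {N a : ℕ} (ha : 1 ≤ a) (haN : a ≤ N) (k : ℕ) : 1 ≤ lin N a k := by
  have := le_lin ha haN k
  have h3 : (0 : ℝ) ≤ k := k.cast_nonneg
  linarith

lemma lin_pos {N a : ℕ} (ha : 1 ≤ a) (haN : a ≤ N) (k : ℕ) : 0 < lin N a k :=
  zero_lt_one.trans_le (one_le_lin ha haN k)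

lemma lin_mono {N a : ℕ} : Monotone (lin N a) := fun k l h => by
  have : (k : ℝ) ≤ l := by exact_mod_cast h
  unfold lin; gcongr

/-- The product `(a / 2) ∏_{1 ≤ j ≤ n} x_j ^ 2 / (x_j ^ 2 - a ^ 2)` with `x_j = N j + a`. -/
noncomputable def coeffZero (N a : ℕ) : ℕ → ℝ
  | 0 => a / 2
  | n + 1 => coeffZero N a n * lin N a (n + 1) ^ 2 / (lin N a (n + 1) ^ 2 - (a : ℝ) ^ 2)

/-- The partial fraction coefficient attached to `n` and `k`; it vanishes for `k > n`. -/
noncomputable def coeff (N a n : ℕ) : ℕ → ℝ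
  | 0 => coeffZero N a n
  | k + 1 => coeff N a n k * (lin N a n - lin N a k) / (lin N a n + lin N a (k + 1))

section coeff

variable {N a : ℕ} (ha : 1 ≤ a) (haN : a ≤ N)

include ha haN in
lemma coeffZero_pos (n : ℕ) : 0 < coeffZero N a n := by
  induction n with
  | zero => simp only [coeffZero]; have : (0 : ℝ) < a := by exact_mod_cast ha
            positivity
  | succ n ih =>
    have h0 := lin_pos ha haN (n + 1)
    have h1 : (a : ℝ) < lin N a (n + 1) := by
      rw [lin_succ]; have := lin_mono (N := N) (a := a) n.zero_le
      rw [lin_zero] at this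
      have h2 : (0 : ℝ) < N := by exact_mod_cast ha.trans haN
      linarith
    have h2 : (0 : ℝ) ≤ a := a.cast_nonneg
    have : 0 < lin N a (n + 1) ^ 2 - (a : ℝ) ^ 2 := by nlinarith
    simp only [coeffZero]; positivity

include ha haN in
lemma coeff_succ_mul (n k : ℕ) :
    coeff N a n (k + 1) * (lin N a n + lin N a (k + 1)) =
      coeff N a n k * (lin N a n - lin N a k) := by
  have h1 := lin_pos ha haN n
  have h2 := lin_pos ha haN (k + 1)
  simp only [coeff]; field_simp

/-- The factor `x_n - x_k` in the recursion vanishes at `k = n`. This removes the boundary terms at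
`n + 1` in the telescoping and Abel summations. -/
lemma coeff_eq_zero {n k : ℕ} (h : n < k) : coeff N a n k = 0 := by
  induction k, h using Nat.le_induction with
  | base => simp [coeff]
  | succ k h ih => simp [coeff, ih]

include ha haN in
lemma coeff_nonneg (n k : ℕ) : 0 ≤ coeff N a n k := by
  rcases lt_or_ge n k with h | h
  · rw [coeff_eq_zero h]
  induction k with
  | zero => exact (coeffZero_pos ha haN n).le
  | succ k ih =>
    have h1 := lin_pos ha haN n
    have h2 := lin_pos ha haN (k + 1)
    have h3 : lin N a k ≤ lin N a n := lin_mono (by omega)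
    have := ih (by omega)
    simp only [coeff]
    exact div_nonneg (mul_nonneg this (by linarith)) (by linarith)

include ha haN in
lemma coeff_succ_le (n k : ℕ) : coeff N a n (k + 1) ≤ coeff N a n k := by
  rcases lt_or_ge n k with h | h
  · rw [coeff_eq_zero h, coeff_eq_zero (by omega)]
  have h1 := lin_pos ha haN n
  have h2 := lin_pos ha haN (k + 1)
  have h4 := lin_pos ha haN k
  have h3 : lin N a k ≤ lin N a n := lin_mono h
  have := coeff_nonneg ha haN n k
  simp only [coeff]
  rw [div_le_iff₀ (by linarith)]
  exact mul_le_mul_of_nonneg_left (by linarith) this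

include ha haN in
-- Dependence on `n`, where the definition only recurses in `k`. Without division it stays valid at
-- `k = n + 1`, where both sides are 0.
lemma coeff_succ_left (n k : ℕ) :
    coeff N a (n + 1) k * (lin N a (n + 1) ^ 2 - lin N a k ^ 2) =
      lin N a (n + 1) ^ 2 * coeff N a n k := by
  have hN : (0 : ℝ) < N := by exact_mod_cast ha.trans haN
  induction k with
  | zero =>
    have h1 : lin N a (n + 1) ^ 2 - (a : ℝ) ^ 2 ≠ 0 := by
      have h1 := lin_pos ha haN n
      have h2 : (0 : ℝ) < a := by exact_mod_cast ha
      have h3 : lin N a 0 ≤ lin N a n := lin_mono n.zero_le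
      rw [lin_zero] at h3
      rw [lin_succ]; nlinarith
    simp only [coeff, coeffZero, lin_zero]; field_simp
  | succ k ih =>
    have hn := lin_pos ha haN n
    have hk := lin_pos ha haN k
    have h1 := coeff_succ_mul ha haN (n + 1) k
    have h2 := coeff_succ_mul ha haN n k
    -- This factor is both `x_n + x_{k+1}` and `x_{n+1} + x_k`, so it occurs in both recursions in
    -- `k`.
    have h3 : lin N a n + lin N a k + N ≠ 0 := by positivity
    rw [lin_succ] at *
    rw [lin_succ N a k] at *
    apply mul_right_cancel₀ h3
    linear_combination (lin N a n - lin N a k) * (lin N a n + lin N a k + N) * h1 -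
      (lin N a n + N) ^ 2 * h2 + (lin N a n - lin N a k) * ih

end coeff

/-! ### Telescoping sums against the coefficients -/

lemma tri_self (k : ℤ) : tri k k = 0 := by simp [tri]

lemma tri_of_ne {k m : ℤ} (h : k ≠ m) : tri k m = 1 := by simp [tri, h]

section telescope

variable {N a : ℕ} (ha : 1 ≤ a) (haN : a ≤ N)

include ha haN in
lemma sum_coeff_mul_lin {m n : ℕ} (h : m ≤ n) :
    ∑ l ∈ Finset.Icc m n, coeff N a n l * lin N a l * 2 ^ tri l m =
      lin N a n * coeff N a n m := by
  -- The partial sum up to `K` has a remainder with the factor `x_n - x_K`, which disappears at `K =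
  -- n`. Weight 1 on the diagonal `l = m` and 2 elsewhere is what makes it telescope.
  suffices H : ∀ K, m ≤ K → ∑ l ∈ Finset.Icc m K, coeff N a n l * lin N a l * 2 ^ tri l m =
      lin N a n * coeff N a n m - (lin N a n - lin N a K) * coeff N a n K by
    rw [H n h]; ring
  intro K hK
  induction K, hK using Nat.le_induction with
  | base => simp [tri_self]; ring
  | succ K hK ih =>
    rw [Finset.sum_Icc_succ_top (by omega), ih, tri_of_ne (by exact_mod_cast (by omega))]
    linear_combination coeff_succ_mul ha haN n K

include ha haN in
lemma sum_alternating_coeff {m n : ℕ} (h : m ≤ n) :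
    ∑ l ∈ Finset.Icc m n, (-1) ^ l * coeff N a n l * 2 ^ tri l m =
      lin N a m / lin N a n * (-1) ^ m * coeff N a n m := by
  have hn := (lin_pos ha haN n).ne'
  suffices H : ∀ K, m ≤ K → ∑ l ∈ Finset.Icc m K, (-1) ^ l * coeff N a n l * 2 ^ tri l m =
      lin N a m / lin N a n * (-1) ^ m * coeff N a n m -
        (-1) ^ K * coeff N a n K * (lin N a K - lin N a n) / lin N a n by
    rw [H n h]; ring
  intro K hK
  induction K, hK using Nat.le_induction with
  | base => simp [tri_self]; field_simp; ring
  | succ K hK ih =>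
    rw [Finset.sum_Icc_succ_top (by omega), ih, tri_of_ne (by exact_mod_cast (by omega))]
    have := coeff_succ_mul ha haN n K
    field_simp
    rw [pow_succ]
    linear_combination - (-1) ^ K * this

/-- The nested sum over `k ≥ l_1 ≥ ⋯ ≥ l_u ≥ m` for the index `{1}^u`. -/
noncomputable def nestedOnes (N a m : ℕ) : ℕ → ℕ → ℝ
  | 0, k => 2 ^ tri k m
  | u + 1, k => ∑ l ∈ Finset.Icc m k, 2 ^ tri k l / lin N a l * nestedOnes N a m u l

lemma nestedSum_replicate (N a m u k : ℕ) :
    nestedSum N a m (List.replicate u 1) k = nestedOnes N a m u k := by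
  induction u generalizing k with
  | zero => simp [nestedSum, nestedOnes]
  | succ u ih =>
    have h : Finset.Icc (m : ℤ) k = (Finset.Icc m k).map Nat.castEmbedding := by
      ext x; simp only [Finset.mem_Icc, Finset.mem_map, Nat.castEmbedding_apply]
      constructor
      · rintro ⟨h1, h2⟩; exact ⟨x.toNat, by omega, by omega⟩
      · rintro ⟨y, hy, rfl⟩; omega
    simp only [List.replicate_succ, nestedSum, nestedOnes, h, Finset.sum_map,
      Nat.castEmbedding_apply, ih, pow_one, lin, Int.cast_natCast]

lemma W_replicate {N a m u k : ℕ} (h : m ≤ k) :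
    W N a k m (List.replicate u 1) = nestedOnes N a m u k := by
  unfold W
  split_ifs with h1
  · exact nestedSum_replicate ..
  · rcases u with _ | u
    · simp [nestedOnes]
    · simp [h] at h1

include ha haN in
-- Summing the outer variable first yields `x_y / x_n`, and `x_y` cancels the denominator of the
-- next level. Each 1 in the string thus costs one factor `1 / x_n`.
lemma sum_coeff_nestedOnes (u : ℕ) {m n : ℕ} (h : m ≤ n) :
    ∑ l ∈ Finset.Icc m n, (-1) ^ l * coeff N a n l * nestedOnes N a m u l =
      lin N a m / lin N a n ^ (u + 1) * (-1) ^ m * coeff N a n m := by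
  have hn := (lin_pos ha haN n).ne'
  induction u with
  | zero => simpa [nestedOnes] using sum_alternating_coeff ha haN h
  | succ u ih =>
    simp only [nestedOnes, Finset.mul_sum]
    rw [Finset.sum_comm' (t' := Finset.Icc m n) (s' := fun l => Finset.Icc l n)
      (by intro x y; simp only [Finset.mem_Icc]; omega)]
    have h1 : ∀ y ∈ Finset.Icc m n, ∑ x ∈ Finset.Icc y n,
        (-1) ^ x * coeff N a n x * (2 ^ tri x y / lin N a y * nestedOnes N a m u y) =
        (-1) ^ y * coeff N a n y * nestedOnes N a m u y / lin N a n := by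
      intro y hy
      have hy' := (lin_pos ha haN y).ne'
      have h2 := sum_alternating_coeff ha haN (Finset.mem_Icc.1 hy).2
      calc _ = (∑ x ∈ Finset.Icc y n, (-1) ^ x * coeff N a n x * 2 ^ tri x y) *
            (nestedOnes N a m u y / lin N a y) := by
            rw [Finset.sum_mul]; exact Finset.sum_congr rfl fun _ _ => by ring
        _ = _ := by rw [h2]; field_simp
    rw [Finset.sum_congr rfl h1, ← Finset.sum_div, ih]
    field_simp
    ring

/-- The real factor that joins two consecutive summation indices `l ≥ k` across an entry `c`. -/
noncomputable def link (N a c l k : ℕ) : ℝ :=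
  (-1) ^ (l * delta c) * lin N a l ^ delta c *
    ((-1) ^ (k * delta c) * lin N a k ^ delta c / lin N a k) * nestedOnes N a k (c - 3) l

include ha haN in
-- Transports an entry `c` from the nested sum to the truncation level `n`. For `c = 1` the sign in
-- `link` cancels the alternation and the unsigned telescoping applies; for `c ≥ 3` the alternating
-- one does.
lemma sum_coeff_link {c : ℕ} (hc : 1 ≤ c) (hc2 : c ≠ 2) {m n : ℕ} (h : m ≤ n) :
    ∑ l ∈ Finset.Icc m n, (-1) ^ l * coeff N a n l * link N a c l m =
      lin N a n ^ 2 / lin N a n ^ c * (-1) ^ m * coeff N a n m := by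
  have hn := (lin_pos ha haN n).ne'
  have hm := (lin_pos ha haN m).ne'
  have hsq : ∀ l : ℕ, (-1 : ℝ) ^ l * (-1) ^ l = 1 := fun l => by
    rw [← mul_pow]; simp
  obtain rfl | hc3 : c = 1 ∨ 3 ≤ c := by omega
  · have h1 := sum_coeff_mul_lin ha haN h
    calc _ = (-1) ^ m * ∑ l ∈ Finset.Icc m n, coeff N a n l * lin N a l * 2 ^ tri l m := by
          rw [Finset.mul_sum]
          refine Finset.sum_congr rfl fun l _ => ?_
          -- Truncated subtraction makes `1 - 3` zero: the empty string of ones.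
          have h0 : nestedOnes N a m (1 - 3) l = 2 ^ tri l m := rfl
          simp only [link, delta, h0, mul_one, pow_one]
          field_simp
          linear_combination (coeff N a n l * lin N a l) * hsq l
      _ = _ := by rw [h1]; field_simp
  · obtain ⟨u, rfl⟩ := Nat.exists_eq_add_of_le hc3
    have hd : delta (3 + u) = 0 := by rw [add_comm]; rfl
    have h1 := sum_coeff_nestedOnes ha haN u h
    calc _ = (∑ l ∈ Finset.Icc m n, (-1) ^ l * coeff N a n l * nestedOnes N a m u l) /
            lin N a m := by
          rw [Finset.sum_div]
          refine Finset.sum_congr rfl fun l _ => ?_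
          simp [link, hd]; ring
      _ = _ := by rw [h1, add_comm 3 u]; field_simp; ring

/-- The quotient `(2a/N)_k / k!`. -/
noncomputable def pochQuot (N a k : ℕ) : ℝ :=
  (ascPochhammer ℝ k).eval (2 * (a : ℝ) / N) / k.factorial

lemma pochQuot_zero : pochQuot N a 0 = 1 := by simp [pochQuot]

include ha haN in
lemma pochQuot_succ (k : ℕ) :
    pochQuot N a (k + 1) * (lin N a (k + 1) - a) = pochQuot N a k * (lin N a k + a) := by
  have hN : (N : ℝ) ≠ 0 := by exact_mod_cast (Nat.lt_of_lt_of_le ha haN).ne'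
  have hf : (k.factorial : ℝ) ≠ 0 := by exact_mod_cast k.factorial_ne_zero
  have hk : (k : ℝ) + 1 ≠ 0 := by positivity
  simp only [pochQuot, ascPochhammer_succ_eval, lin, Nat.factorial_succ]
  push_cast
  field_simp
  ring

include ha haN in
lemma pochQuot_nonneg (k : ℕ) : 0 ≤ pochQuot N a k := by
  have hN : (0 : ℝ) < N := by exact_mod_cast ha.trans haN
  have h2 : (0 : ℝ) < a := by exact_mod_cast ha
  exact div_nonneg (ascPochhammer_pos k _ (by positivity)).le (by positivity)

include ha haN in
-- Since `2a/N ≤ 2`, the extreme case is `(2)_k / k! = k + 1`.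
lemma pochQuot_le (k : ℕ) : pochQuot N a k ≤ k + 1 := by
  have hN : (0 : ℝ) < N := by exact_mod_cast ha.trans haN
  have haN' : (a : ℝ) ≤ N := by exact_mod_cast haN
  induction k with
  | zero => simp [pochQuot_zero]
  | succ k ih =>
    have h := pochQuot_succ ha haN k
    have hp : 0 < lin N a (k + 1) - a := by rw [lin]; push_cast; ring_nf; positivity
    rw [← mul_le_mul_iff_left₀ hp, h]
    have h1 : 0 ≤ lin N a k + a := by have := lin_pos ha haN k; positivity
    refine (mul_le_mul_of_nonneg_right ih h1).trans ?_
    have hk : (0 : ℝ) ≤ k := k.cast_nonneg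
    unfold lin; push_cast
    nlinarith

include ha haN in
-- End of the chain: the recursions of `coeff` and `pochQuot` together telescope. The closed form
-- vanishes at the lower end because `x_0 = a`, at the upper end because `coeff N a n (n + 1) = 0`;
-- `n ≠ 0` permits division by `x_n - a`.
lemma sum_alternating_coeff_pochQuot {n : ℕ} (hn : n ≠ 0) :
    ∑ k ∈ Finset.range (n + 1), (-1) ^ k * coeff N a n k * (2 * lin N a k * pochQuot N a k) = 0 := by
  have hN : (0 : ℝ) < N := by exact_mod_cast ha.trans haN
  have hna : lin N a n - a ≠ 0 := by
    have : (n : ℝ) ≠ 0 := by exact_mod_cast hn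
    simpa [lin, hn] using (Nat.lt_of_lt_of_le ha haN).ne'
  have H : ∀ K, ∑ k ∈ Finset.range K,
      (-1) ^ k * coeff N a n k * (2 * lin N a k * pochQuot N a k) =
      -((lin N a K - a) * (lin N a n + lin N a K) / (lin N a n - a) *
        ((-1) ^ K * coeff N a n K * pochQuot N a K)) := by
    intro K
    induction K with
    | zero => simp [lin_zero]
    | succ K ih =>
      rw [Finset.sum_range_succ, ih]
      have h1 := pochQuot_succ ha haN K
      have h2 := coeff_succ_mul ha haN n K
      field_simp
      rw [pow_succ]
      linear_combination (-(-1) ^ K * (lin N a (K + 1) - a) * pochQuot N a (K + 1)) * h2 -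
        (-1) ^ K * coeff N a n K * (lin N a n - lin N a K) * h1
  rw [H, coeff_eq_zero (Nat.lt_succ_self n)]; simp

end telescope

/-! ### Truncated sums, iterated sums and their recursions -/

/-- The total `G` of `g` satisfies `G = S + y G`. Summability comes first: the same relation for
norms bounds all finite rectangles by `M / (1 - ‖y‖)`. -/
lemma hasSum_of_geometric_recursion {β : Type*} {g h : ℕ × β → ℂ} {y S : ℂ} (hy : ‖y‖ < 1)
    (h0 : ∀ x, g (0, x) = h (0, x)) (hs : ∀ b x, g (b + 1, x) = h (b + 1, x) + y * g (b, x))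
    (hS : HasSum h S) : HasSum g (S / (1 - y)) := by
  classical
  have hsum : Summable g := by
    apply Summable.of_norm
    have hn : Summable fun p => ‖h p‖ := hS.summable.norm
    set M := ∑' p, ‖h p‖
    have hM : 0 ≤ M := tsum_nonneg fun _ => norm_nonneg _
    have hy' : 0 < 1 - ‖y‖ := by linarith
    have key : ∀ (T : Finset β) (B : ℕ),
        ∑ b ∈ Finset.range B, ∑ x ∈ T, ‖g (b, x)‖ ≤ M / (1 - ‖y‖) := by
      intro T B
      induction B with
      | zero => simp only [Finset.range_zero, Finset.sum_empty]; positivity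
      | succ B ih =>
        have h1 : ∑ b ∈ Finset.range (B + 1), ∑ x ∈ T, ‖h (b, x)‖ ≤ M := by
          rw [← Finset.sum_product']
          exact hn.sum_le_tsum _ fun _ _ => norm_nonneg _
        rw [Finset.sum_range_succ'] at h1 ⊢
        have h2 : ∑ b ∈ Finset.range B, ∑ x ∈ T, ‖g (b + 1, x)‖ ≤
            ∑ b ∈ Finset.range B, ∑ x ∈ T, ‖h (b + 1, x)‖ +
              ‖y‖ * ∑ b ∈ Finset.range B, ∑ x ∈ T, ‖g (b, x)‖ := by
          simp only [Finset.mul_sum, ← Finset.sum_add_distrib]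
          refine Finset.sum_le_sum fun b _ => Finset.sum_le_sum fun x _ => ?_
          rw [hs, ← norm_mul]
          exact norm_add_le _ _
        have h3 : ‖y‖ * ∑ b ∈ Finset.range B, ∑ x ∈ T, ‖g (b, x)‖ ≤
            ‖y‖ * (M / (1 - ‖y‖)) := by gcongr
        have h4 : M + ‖y‖ * (M / (1 - ‖y‖)) = M / (1 - ‖y‖) := by field_simp; ring
        simp only [h0] at *
        linarith
    refine summable_of_sum_le (c := M / (1 - ‖y‖)) (fun _ => norm_nonneg _) fun u => ?_
    obtain ⟨B, hB⟩ : ∃ B, ∀ p ∈ u, p.1 < B :=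
      ⟨(u.sup Prod.fst) + 1, fun p hp => Nat.lt_succ_of_le (Finset.le_sup (f := Prod.fst) hp)⟩
    refine le_trans ?_ (key (u.image Prod.snd) B)
    rw [← Finset.sum_product']
    refine Finset.sum_le_sum_of_subset_of_nonneg (fun p hp => ?_) fun _ _ _ => norm_nonneg _
    exact Finset.mem_product.2 ⟨Finset.mem_range.2 (hB p hp), Finset.mem_image_of_mem _ hp⟩
  obtain ⟨G, hG⟩ := hsum
  have hinj : Function.Injective fun p : ℕ × β => (p.1 + 1, p.2) := by
    rintro ⟨a, b⟩ ⟨c, d⟩ h; simp at h; simp [h]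
  have h1 : HasSum (fun p => g p - h p) (y * G) := by
    rw [← hinj.hasSum_iff]
    · refine (hG.mul_left y).congr_fun ?_
      rintro ⟨b, x⟩
      simp [hs]
    · rintro ⟨b, x⟩ hp
      rcases b with _ | b
      · simp [h0]
      · exact absurd ⟨(b, x), rfl⟩ hp
  have h2 := h1.unique (hG.sub hS)
  have h3 : 1 - y ≠ 0 := fun h => by
    rw [sub_eq_zero] at h; rw [← h] at hy; simp at hy
  have : G = S / (1 - y) := by field_simp; linear_combination -h2
  exact this ▸ hG

/-- The multiple `t`-star sum restricted to `n ≥ k_1 ≥ ⋯ ≥ k_u ≥ 0`. -/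
noncomputable def tTrunc (N a : ℕ) : List ℕ → ℕ → ℝ
  | [], _ => 1
  | s :: t, n => ∑ m ∈ Finset.range (n + 1), 1 / lin N a m ^ s * tTrunc N a t m

lemma tTrunc_cons_zero (N a s : ℕ) (t : List ℕ) :
    tTrunc N a (s :: t) 0 = 1 / lin N a 0 ^ s * tTrunc N a t 0 := by
  simp [tTrunc]

lemma tTrunc_cons_succ (N a s : ℕ) (t : List ℕ) (n : ℕ) :
    tTrunc N a (s :: t) (n + 1) =
      tTrunc N a (s :: t) n + 1 / lin N a (n + 1) ^ s * tTrunc N a t (n + 1) := by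
  simp only [tTrunc]; rw [Finset.sum_range_succ]

lemma blockIndex_zero (c : Fin 0 → ℕ) (b : Fin 1 → ℕ) :
    blockIndex c b = List.replicate (b 0) 2 := by simp [blockIndex]

lemma blockIndex_cons_zero {d : ℕ} (c : Fin (d + 1) → ℕ) (b : Fin (d + 1) → ℕ) :
    blockIndex c (Fin.cons 0 b : Fin (d + 2) → ℕ) = c 0 :: blockIndex (Fin.tail c) b := by
  simp [blockIndex, List.ofFn_succ, Fin.tail]

lemma blockIndex_cons_succ {d : ℕ} (c : Fin d → ℕ) (m : ℕ) (b : Fin d → ℕ) :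
    blockIndex c (Fin.cons (m + 1) b : Fin (d + 1) → ℕ) =
      2 :: blockIndex c (Fin.cons m b : Fin (d + 1) → ℕ) := by
  simp [blockIndex, List.replicate_succ]

/-- The iterated sum over `k ≥ l_1 ≥ ⋯ ≥ l_d` of `u_1(k, l_1) ⋯ u_d(l_{d-1}, l_d) g(l_d)`. -/
def iterSum {R : Type*} [CommSemiring R] (g : ℕ → R) : (d : ℕ) → (Fin d → ℕ → ℕ → R) → ℕ → R
  | 0, _ => g
  | d + 1, u => fun k => ∑ l ∈ Finset.range (k + 1), u 0 k l * iterSum g d (Fin.tail u) l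

/-- The factors joining consecutive indices in the nested sum. -/
noncomputable def kernel (N a : ℕ) {d : ℕ} (c : Fin d → ℕ) (z : Fin (d + 1) → ℂ) :
    Fin d → ℕ → ℕ → ℂ :=
  fun i l k => (link N a (c i) l k : ℂ) / ((lin N a k : ℂ) ^ 2 - z i.succ ^ 2)

/-- The nested sum over `k_1 ≥ ⋯ ≥ k_d` with `k_0 = k` fixed. -/
noncomputable def inner (N a : ℕ) {d : ℕ} (c : Fin d → ℕ) (z : Fin (d + 1) → ℂ) (k : ℕ) : ℂ :=
  iterSum (fun k => ((lin N a k * pochQuot N a k : ℝ) : ℂ)) d (kernel N a c z) k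

lemma inner_zero (N a : ℕ) (c : Fin 0 → ℕ) (z : Fin 1 → ℂ) (k : ℕ) :
    inner N a c z k = ((lin N a k * pochQuot N a k : ℝ) : ℂ) := rfl

lemma inner_succ (N a : ℕ) {d : ℕ} (c : Fin (d + 1) → ℕ) (z : Fin (d + 2) → ℂ) (k : ℕ) :
    inner N a c z k = ∑ l ∈ Finset.range (k + 1),
      (link N a (c 0) k l : ℂ) / ((lin N a l : ℂ) ^ 2 - z 1 ^ 2) *
        inner N a (Fin.tail c) (Fin.tail z) l := rfl

/-- The nested sum with `k_0 = k` fixed, including the factor of `k_0`. -/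
noncomputable def outer (N a : ℕ) {d : ℕ} (c : Fin d → ℕ) (z : Fin (d + 1) → ℂ) (k : ℕ) : ℂ :=
  2 * (-1) ^ k / ((lin N a k : ℂ) ^ 2 - z 0 ^ 2) * inner N a c z k

/-- The finite form of the nested sum, weighted by the partial fraction coefficients. -/
noncomputable def finiteSum (N a : ℕ) {d : ℕ} (c : Fin d → ℕ) (z : Fin (d + 1) → ℂ) (n : ℕ) :
    ℂ :=
  ∑ k ∈ Finset.range (n + 1), (coeff N a n k : ℂ) * outer N a c z k

/-! ### The finite identity -/

section recursion

variable {N a : ℕ} (ha : 1 ≤ a) (haN : a ≤ N)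

include ha haN in
lemma sq_norm_lt {z : ℂ} (hz : ‖z‖ < 1) (k : ℕ) : ‖z ^ 2 / (lin N a k : ℂ) ^ 2‖ < 1 := by
  have h1 := one_le_lin ha haN k
  rw [norm_div, norm_pow, norm_pow, Complex.norm_real, Real.norm_of_nonneg (by linarith),
    div_lt_one (by positivity)]
  have := norm_nonneg z
  nlinarith

include ha haN in
lemma lin_sq_sub_ne_zero {z : ℂ} (hz : ‖z‖ < 1) (k : ℕ) :
    (lin N a k : ℂ) ^ 2 - z ^ 2 ≠ 0 := by
  have h1 : (lin N a k : ℂ) ≠ 0 := by exact_mod_cast (lin_pos ha haN k).ne'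
  intro h
  have h2 := sq_norm_lt ha haN hz k
  rw [← sub_eq_zero.1 h, div_self (pow_ne_zero _ h1)] at h2
  simp at h2

include ha haN in
-- Write `x_{n+1}² - z_0² = (x_{n+1}² - x_k²) + (x_k² - z_0²)` in each term: the first part lowers
-- `n` by `coeff_succ_left`, the second cancels the denominator of `outer`.
lemma finiteSum_succ_mul {d : ℕ} (c : Fin d → ℕ) {z : Fin (d + 1) → ℂ} (hz : ‖z 0‖ < 1) (n : ℕ) :
    ((lin N a (n + 1) : ℂ) ^ 2 - z 0 ^ 2) * finiteSum N a c z (n + 1) =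
      (lin N a (n + 1) : ℂ) ^ 2 * finiteSum N a c z n +
      ∑ k ∈ Finset.range (n + 1 + 1), (coeff N a (n + 1) k : ℂ) *
        (2 * (-1) ^ k * inner N a c z k) := by
  have h1 : finiteSum N a c z n =
      ∑ k ∈ Finset.range (n + 1 + 1), (coeff N a n k : ℂ) * outer N a c z k := by
    rw [Finset.sum_range_succ, coeff_eq_zero (Nat.lt_succ_self n)]
    simp [finiteSum]
  rw [h1, finiteSum, Finset.mul_sum, Finset.mul_sum, ← Finset.sum_add_distrib]
  refine Finset.sum_congr rfl fun k _ => ?_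
  have h2 : (coeff N a (n + 1) k : ℂ) * ((lin N a (n + 1) : ℂ) ^ 2 - (lin N a k : ℂ) ^ 2) =
      (lin N a (n + 1) : ℂ) ^ 2 * coeff N a n k := by
    exact_mod_cast coeff_succ_left ha haN n k
  have h3 := lin_sq_sub_ne_zero ha haN hz k
  rw [outer]
  field_simp
  linear_combination inner N a c z k * h2

include ha haN in
lemma sum_coeff_inner {d : ℕ} {c : Fin (d + 1) → ℕ} (hc : 1 ≤ c 0 ∧ c 0 ≠ 2)
    (z : Fin (d + 2) → ℂ) (n : ℕ) :
    ∑ k ∈ Finset.range (n + 1), (coeff N a n k : ℂ) * (2 * (-1) ^ k * inner N a c z k) =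
      (lin N a n : ℂ) ^ 2 / (lin N a n : ℂ) ^ (c 0) *
        finiteSum N a (Fin.tail c) (Fin.tail z) n := by
  simp only [inner_succ, Finset.mul_sum]
  rw [Finset.sum_comm' (t' := Finset.range (n + 1)) (s' := fun l => Finset.Icc l n)
    (by intro x y; simp only [Finset.mem_Icc, Finset.mem_range]; omega),
    finiteSum, Finset.mul_sum]
  refine Finset.sum_congr rfl fun k hk => ?_
  have hk' : k ≤ n := by simpa [Nat.lt_succ_iff] using hk
  have h1 : ∑ l ∈ Finset.Icc k n, (-1) ^ l * (coeff N a n l : ℂ) * (link N a (c 0) l k : ℂ) =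
      (lin N a n : ℂ) ^ 2 / (lin N a n : ℂ) ^ (c 0) * (-1) ^ k * coeff N a n k := by
    exact_mod_cast sum_coeff_link ha haN hc.1 hc.2 hk'
  calc _ = (∑ l ∈ Finset.Icc k n, (-1) ^ l * (coeff N a n l : ℂ) * (link N a (c 0) l k : ℂ)) *
        (2 / ((lin N a k : ℂ) ^ 2 - z 1 ^ 2) * inner N a (Fin.tail c) (Fin.tail z) k) := by
        rw [Finset.sum_mul]; exact Finset.sum_congr rfl fun _ _ => by ring
    _ = _ := by
      have : (Fin.tail z) 0 = z 1 := rfl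
      rw [h1, outer, this]; ring

include ha haN in
lemma sum_coeff_inner_zero (c : Fin 0 → ℕ) (z : Fin 1 → ℂ) {n : ℕ} (hn : n ≠ 0) :
    ∑ k ∈ Finset.range (n + 1), (coeff N a n k : ℂ) * (2 * (-1) ^ k * inner N a c z k) = 0 := by
  have h : ∑ k ∈ Finset.range (n + 1), (-1) ^ k * (coeff N a n k : ℂ) *
      (2 * (lin N a k : ℂ) * (pochQuot N a k : ℂ)) = 0 := by
    exact_mod_cast sum_alternating_coeff_pochQuot ha haN hn
  rw [← h]
  refine Finset.sum_congr rfl fun k _ => ?_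
  rw [inner_zero]; push_cast; ring

lemma finiteSum_zero_mul {N a : ℕ} (ha : 1 ≤ a) (haN : a ≤ N) {d : ℕ} (c : Fin d → ℕ)
    {z : Fin (d + 1) → ℂ} (hz : ‖z 0‖ < 1) :
    ((lin N a 0 : ℂ) ^ 2 - z 0 ^ 2) * finiteSum N a c z 0 =
      ∑ k ∈ Finset.range (0 + 1), (coeff N a 0 k : ℂ) * (2 * (-1) ^ k * inner N a c z k) := by
  have h3 := lin_sq_sub_ne_zero ha haN hz 0
  simp only [finiteSum, outer, zero_add, Finset.sum_range_one]
  field_simp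

/-- The generating series of the truncated `t`-star sums, term by term. -/
noncomputable def truncTerm (N a : ℕ) {d : ℕ} (c : Fin d → ℕ) (z : Fin (d + 1) → ℂ) (n : ℕ)
    (b : Fin (d + 1) → ℕ) : ℂ :=
  (tTrunc N a (blockIndex c b) n : ℂ) * ∏ j, z j ^ (2 * b j)

/-- Separates `b_0` from the other exponents; the recursion in `b_0` is geometric, later with ratio
`z_0² / x_n²`. -/
lemma hasSum_truncTerm_of_recursion {d : ℕ} {c : Fin d → ℕ} {z : Fin (d + 1) → ℂ} {n : ℕ} {y : ℂ}
    (hy : ‖y‖ < 1) {h : ℕ × (Fin d → ℕ) → ℂ} {S : ℂ} (hS : HasSum h S)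
    (h0 : ∀ b, truncTerm N a c z n (Fin.cons 0 b) = h (0, b))
    (hs : ∀ m b, truncTerm N a c z n (Fin.cons (m + 1) b) =
      h (m + 1, b) + y * truncTerm N a c z n (Fin.cons m b)) :
    HasSum (truncTerm N a c z n) (S / (1 - y)) := by
  rw [← (Fin.consEquiv fun _ : Fin (d + 1) => ℕ).hasSum_iff]
  exact hasSum_of_geometric_recursion hy h0 hs hS

lemma truncTerm_cons_succ_zero {d : ℕ} (c : Fin d → ℕ) (z : Fin (d + 1) → ℂ) (m : ℕ)
    (b : Fin d → ℕ) :
    truncTerm N a c z 0 (Fin.cons (m + 1) b) =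
      z 0 ^ 2 / (lin N a 0 : ℂ) ^ 2 * truncTerm N a c z 0 (Fin.cons m b) := by
  simp only [truncTerm, blockIndex_cons_succ, tTrunc_cons_zero, Fin.prod_univ_succ, Fin.cons_zero,
    Fin.cons_succ]
  push_cast; ring

lemma truncTerm_cons_succ_succ {d : ℕ} (c : Fin d → ℕ) (z : Fin (d + 1) → ℂ) (m n : ℕ)
    (b : Fin d → ℕ) :
    truncTerm N a c z (n + 1) (Fin.cons (m + 1) b) = truncTerm N a c z n (Fin.cons (m + 1) b) +
      z 0 ^ 2 / (lin N a (n + 1) : ℂ) ^ 2 * truncTerm N a c z (n + 1) (Fin.cons m b) := by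
  simp only [truncTerm, blockIndex_cons_succ, tTrunc_cons_succ, Fin.prod_univ_succ, Fin.cons_zero,
    Fin.cons_succ]
  push_cast; ring

lemma truncTerm_cons_zero_zero {d : ℕ} (c : Fin (d + 1) → ℕ) (z : Fin (d + 2) → ℂ)
    (b : Fin (d + 1) → ℕ) :
    truncTerm N a c z 0 (Fin.cons 0 b) =
      1 / (lin N a 0 : ℂ) ^ (c 0) * truncTerm N a (Fin.tail c) (Fin.tail z) 0 b := by
  simp only [truncTerm, blockIndex_cons_zero, tTrunc_cons_zero, Fin.prod_univ_succ (n := d + 1),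
    Fin.cons_zero, Fin.cons_succ, Fin.tail]
  push_cast; ring

lemma truncTerm_cons_zero_succ {d : ℕ} (c : Fin (d + 1) → ℕ) (z : Fin (d + 2) → ℂ) (n : ℕ)
    (b : Fin (d + 1) → ℕ) :
    truncTerm N a c z (n + 1) (Fin.cons 0 b) = truncTerm N a c z n (Fin.cons 0 b) +
      1 / (lin N a (n + 1) : ℂ) ^ (c 0) *
        truncTerm N a (Fin.tail c) (Fin.tail z) (n + 1) b := by
  simp only [truncTerm, blockIndex_cons_zero, tTrunc_cons_succ, Fin.prod_univ_succ (n := d + 1),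
    Fin.cons_zero, Fin.cons_succ, Fin.tail]
  push_cast; ring

lemma truncTerm_nil (c : Fin 0 → ℕ) (z : Fin 1 → ℂ) (n : ℕ) (b : Fin 0 → ℕ) :
    truncTerm N a c z n (Fin.cons 0 b) = 1 := by
  simp [truncTerm, blockIndex_zero, tTrunc]

lemma hasSum_indicator_fst {β : Type*} {f : β → ℂ} {S : ℂ} (h : HasSum f S) :
    HasSum (fun p : ℕ × β => if p.1 = 0 then f p.2 else 0) S := by
  have hinj : Function.Injective fun x : β => ((0 : ℕ), x) := fun x y h => by simpa using h
  rw [← hinj.hasSum_iff]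
  · simpa [Function.comp_def] using h
  · rintro ⟨m, x⟩ hp
    rcases m with _ | m
    · exact absurd ⟨x, rfl⟩ hp
    · simp

include ha haN in
lemma div_one_sub_eq_finiteSum {d : ℕ} {c : Fin d → ℕ} {z : Fin (d + 1) → ℂ} (hz : ‖z 0‖ < 1)
    {k : ℕ} {S : ℂ} (h : ((lin N a k : ℂ) ^ 2 - z 0 ^ 2) * finiteSum N a c z k =
      (lin N a k : ℂ) ^ 2 * S) :
    S / (1 - z 0 ^ 2 / (lin N a k : ℂ) ^ 2) = finiteSum N a c z k := by
  have hx : (lin N a k : ℂ) ≠ 0 := by exact_mod_cast (lin_pos ha haN k).ne'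
  have h0 := lin_sq_sub_ne_zero ha haN hz k
  have h1 : 1 - z 0 ^ 2 / (lin N a k : ℂ) ^ 2 =
      ((lin N a k : ℂ) ^ 2 - z 0 ^ 2) / (lin N a k : ℂ) ^ 2 := by field_simp
  rw [h1, ← mul_right_inj' h0, h]
  field_simp

include ha haN in
/-- The finite identity: the generating series of the truncated `t`-star sums is a finite nested
sum. -/
theorem hasSum_truncTerm {d : ℕ} {c : Fin d → ℕ} (hc : ∀ j, 1 ≤ c j ∧ c j ≠ 2)
    {z : Fin (d + 1) → ℂ} (hz : ∀ j, ‖z j‖ < 1) (n : ℕ) :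
    HasSum (truncTerm N a c z n) (finiteSum N a c z n) := by
  induction d generalizing n with
  | zero =>
    have hu : HasSum (fun _ : Fin 0 → ℕ => (1 : ℂ)) 1 := by
      simp
    induction n with
    | zero =>
      have h := hasSum_truncTerm_of_recursion (c := c) (z := z) (n := 0) (N := N) (a := a)
        (sq_norm_lt ha haN (hz 0) 0) (hasSum_indicator_fst hu)
        (fun b => by simpa using truncTerm_nil c z 0 b)
        (fun m b => by simpa using truncTerm_cons_succ_zero c z m b)
      rwa [div_one_sub_eq_finiteSum ha haN (hz 0)] at h
      rw [finiteSum_zero_mul ha haN c (hz 0)]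
      simp [coeff, coeffZero, inner_zero, pochQuot_zero, lin_zero]
      ring
    | succ n ih =>
      rw [← (Fin.consEquiv fun _ : Fin 1 => ℕ).hasSum_iff] at ih
      have h := hasSum_truncTerm_of_recursion (c := c) (z := z) (n := n + 1) (N := N) (a := a)
        (sq_norm_lt ha haN (hz 0) (n + 1)) ih
        -- On the row `b_0 = 0` the index is empty, so its truncated sum is 1 at every level.
        (fun b => (truncTerm_nil c z (n + 1) b).trans (truncTerm_nil c z n b).symm)
        (fun m b => truncTerm_cons_succ_succ c z m n b)
      rwa [div_one_sub_eq_finiteSum ha haN (hz 0)] at h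
      rw [finiteSum_succ_mul ha haN c (hz 0), sum_coeff_inner_zero ha haN c z (by omega), add_zero]
  | succ d ihd =>
    have ihd' : ∀ n, HasSum (truncTerm N a (Fin.tail c) (Fin.tail z) n)
        (finiteSum N a (Fin.tail c) (Fin.tail z) n) := fun n =>
      ihd (c := Fin.tail c) (fun j => hc j.succ) (z := Fin.tail z) (fun j => hz j.succ) n
    clear ihd
    induction n with
    | zero =>
      have h := hasSum_truncTerm_of_recursion (c := c) (z := z) (n := 0) (N := N) (a := a)
        (sq_norm_lt ha haN (hz 0) 0)
        (hasSum_indicator_fst ((ihd' 0).mul_left (1 / (lin N a 0 : ℂ) ^ (c 0))))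
        (fun b => by simpa using truncTerm_cons_zero_zero c z b)
        (fun m b => by simpa using truncTerm_cons_succ_zero c z m b)
      rwa [div_one_sub_eq_finiteSum ha haN (hz 0)] at h
      rw [finiteSum_zero_mul ha haN c (hz 0), sum_coeff_inner ha haN (hc 0)]
      ring
    | succ n ih =>
      rw [← (Fin.consEquiv fun _ : Fin (d + 2) => ℕ).hasSum_iff] at ih
      have h := hasSum_truncTerm_of_recursion (c := c) (z := z) (n := n + 1) (N := N) (a := a)
        (sq_norm_lt ha haN (hz 0) (n + 1))
        -- The source of the recursion is the series at level `n` plus, on the row `b_0 = 0` only,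
        -- the tail series times `x_{n+1}^{-c_1}`.
        (ih.add (hasSum_indicator_fst
          ((ihd' (n + 1)).mul_left (1 / (lin N a (n + 1) : ℂ) ^ (c 0)))))
        (fun b => by simpa [Fin.consEquiv] using truncTerm_cons_zero_succ c z n b)
        (fun m b => by simpa [Fin.consEquiv] using truncTerm_cons_succ_succ c z m n b)
      rwa [div_one_sub_eq_finiteSum ha haN (hz 0)] at h
      rw [finiteSum_succ_mul ha haN c (hz 0), sum_coeff_inner ha haN (hc 0)]
      ring

end recursion

/-! ### Sums over antitone tuples as iterated sums -/

open Classical in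
/-- The finite set of antitone `m`-tuples with entries at most `K`. -/
noncomputable def antiTuples (m K : ℕ) : Finset (Fin m → ℕ) :=
  (Fintype.piFinset fun _ => Finset.range (K + 1)).filter fun k => Antitone k

lemma mem_antiTuples {m K : ℕ} {k : Fin m → ℕ} :
    k ∈ antiTuples m K ↔ (∀ i, k i ≤ K) ∧ Antitone k := by
  simp [antiTuples, Fintype.mem_piFinset]

lemma tuplesLE_eq (d K : ℕ) : tuplesLE d K = antiTuples (d + 1) K := rfl

lemma antitone_cons_iff {m k₀ : ℕ} {k : Fin m → ℕ} :
    Antitone (Fin.cons k₀ k : Fin (m + 1) → ℕ) ↔ (∀ i, k i ≤ k₀) ∧ Antitone k := by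
  constructor
  · intro h
    exact ⟨fun i => by simpa using h (Fin.zero_le i.succ),
      fun i j hij => by simpa using h (Fin.succ_le_succ_iff.2 hij)⟩
  · rintro ⟨h1, h2⟩ i j hij
    induction i using Fin.cases with
    | zero => induction j using Fin.cases with
      | zero => simp
      | succ j => simpa using h1 j
    | succ i => induction j using Fin.cases with
      | zero => simp at hij
      | succ j => simpa using h2 (Fin.succ_le_succ_iff.1 hij)

lemma sum_antiTuples_succ {M : Type*} [AddCommMonoid M] (m K : ℕ) (f : (Fin (m + 1) → ℕ) → M) :
    ∑ k ∈ antiTuples (m + 1) K, f k =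
      ∑ k₀ ∈ Finset.range (K + 1), ∑ k ∈ antiTuples m k₀, f (Fin.cons k₀ k) := by
  rw [Finset.sum_sigma']
  symm
  refine Finset.sum_bij' (fun p _ => Fin.cons p.1 p.2) (fun k _ => ⟨k 0, Fin.tail k⟩)
    ?_ ?_ ?_ ?_ ?_
  · rintro ⟨k₀, k⟩ h
    simp only [Finset.mem_sigma, Finset.mem_range, Nat.lt_succ_iff, mem_antiTuples] at h
    refine mem_antiTuples.2 ⟨fun i => ?_, antitone_cons_iff.2 h.2⟩
    induction i using Fin.cases with
    | zero => simpa using h.1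
    | succ i => simpa using (h.2.1 i).trans h.1
  · intro k h
    rw [mem_antiTuples] at h
    have h2 := h.2
    rw [← Fin.cons_self_tail k, antitone_cons_iff] at h2
    simp only [Finset.mem_sigma, Finset.mem_range, Nat.lt_succ_iff, mem_antiTuples]
    exact ⟨h.1 0, h2⟩
  · rintro ⟨k₀, k⟩ _; simp
  · intro k _; simp
  · rintro ⟨k₀, k⟩ _; rfl

lemma antiTuples_zero (K : ℕ) : antiTuples 0 K = {Fin.elim0} := by
  ext k
  simp only [mem_antiTuples, Finset.mem_singleton]
  exact ⟨fun _ => Subsingleton.elim _ _, fun _ => ⟨fun i => i.elim0, fun i => i.elim0⟩⟩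

/-- The arbitrary weight `φ` on the first index lets the induction absorb the kernel from the
removed index. -/
lemma sum_antiTuples_iterSum {R : Type*} [CommSemiring R] (g : ℕ → R) {d : ℕ}
    (u : Fin d → ℕ → ℕ → R) (φ : ℕ → R) (K : ℕ) :
    ∑ k ∈ antiTuples (d + 1) K,
      φ (k 0) * ((∏ i : Fin d, u i (k i.castSucc) (k i.succ)) * g (k (Fin.last d))) =
    ∑ k₀ ∈ Finset.range (K + 1), φ k₀ * iterSum g d u k₀ := by
  induction d generalizing φ K with
  | zero =>
    rw [sum_antiTuples_succ]
    refine Finset.sum_congr rfl fun k₀ _ => ?_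
    simp [antiTuples_zero, iterSum]
  | succ d ih =>
    rw [sum_antiTuples_succ]
    refine Finset.sum_congr rfl fun k₀ _ => ?_
    simp only [iterSum]
    rw [← ih (Fin.tail u) (fun l => u 0 k₀ l) k₀, Finset.mul_sum]
    refine Finset.sum_congr rfl fun k _ => ?_
    rw [Fin.prod_univ_succ]
    simp only [Fin.cons_zero, Fin.cons_succ, Fin.castSucc_zero, Fin.tail, ← Fin.succ_castSucc,
      ← Fin.succ_last]
    ring

lemma sum_antiTuples_tStarTerm (N a : ℕ) (s : List ℕ) (n : ℕ) :
    ∑ k ∈ antiTuples s.length n, tStarTerm N a s k = tTrunc N a s n := by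
  induction s generalizing n with
  | nil => simp [antiTuples_zero, tStarTerm, tTrunc]
  | cons s t ih =>
    simp only [List.length_cons]
    rw [sum_antiTuples_succ, tTrunc]
    refine Finset.sum_congr rfl fun m _ => ?_
    rw [← ih, Finset.mul_sum]
    refine Finset.sum_congr rfl fun k _ => ?_
    simp only [tStarTerm]
    erw [Fin.prod_univ_succ]
    simp [lin]

lemma tendsto_antiTuples_subtype (m : ℕ) :
    Tendsto (fun K => (antiTuples m K).subtype fun k => Antitone k) atTop atTop := by
  classical
  refine tendsto_atTop_finset_of_monotone (fun K L h k hk => ?_) fun k => ⟨∑ i, k.1 i, ?_⟩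
  · simp only [Finset.mem_subtype, mem_antiTuples] at hk ⊢
    exact ⟨fun i => (hk.1 i).trans h, hk.2⟩
  · simp only [Finset.mem_subtype, mem_antiTuples]
    exact ⟨fun i => Finset.single_le_sum (f := k.1) (fun _ _ => Nat.zero_le _) (Finset.mem_univ i),
      k.2⟩

lemma tendsto_sum_antiTuples {M : Type*} [AddCommMonoid M] [TopologicalSpace M] {m : ℕ}
    {f : (Fin m → ℕ) → M} {S : M} (h : HasSum (fun k : {k : Fin m → ℕ // Antitone k} => f k) S) :
    Tendsto (fun K => ∑ k ∈ antiTuples m K, f k) atTop (𝓝 S) := by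
  refine (Tendsto.comp h (tendsto_antiTuples_subtype m)).congr fun K => ?_
  exact Finset.sum_subtype_of_mem f fun k hk => (mem_antiTuples.1 hk).2

lemma summable_of_sum_antiTuples_le {m : ℕ} {f : (Fin m → ℕ) → ℝ} (hf : ∀ k, 0 ≤ f k) {M : ℝ}
    (h : ∀ K, ∑ k ∈ antiTuples m K, f k ≤ M) :
    Summable fun k : {k : Fin m → ℕ // Antitone k} => f k := by
  refine summable_of_sum_le (c := M) (fun k => hf k) fun u => ?_
  obtain ⟨K, hK⟩ := ((tendsto_antiTuples_subtype m).eventually_ge_atTop u).exists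
  calc _ ≤ ∑ k ∈ (antiTuples m K).subtype fun k => Antitone k, f k :=
        Finset.sum_le_sum_of_subset_of_nonneg hK fun k _ _ => hf k
    _ = ∑ k ∈ antiTuples m K, f k :=
        Finset.sum_subtype_of_mem f fun k hk => (mem_antiTuples.1 hk).2
    _ ≤ M := h K

lemma sum_antiTuples_le_tsum {m : ℕ} {f : (Fin m → ℕ) → ℝ} (hf : ∀ k, 0 ≤ f k)
    (h : Summable fun k : {k : Fin m → ℕ // Antitone k} => f k) (K : ℕ) :
    ∑ k ∈ antiTuples m K, f k ≤ ∑' k : {k : Fin m → ℕ // Antitone k}, f k := by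
  classical
  rw [← Finset.sum_subtype_of_mem (p := fun k => Antitone k) f fun k hk => (mem_antiTuples.1 hk).2]
  exact h.sum_le_tsum _ fun k _ => hf k

/-- The factor of the outermost index `k_0`. -/
noncomputable def outerFactor (N a : ℕ) (z : ℂ) (k : ℕ) : ℂ :=
  2 * (-1) ^ k / ((lin N a k : ℂ) ^ 2 - z ^ 2)

lemma pochQuot_cast (N a k : ℕ) :
    (pochQuot N a k : ℂ) = (ascPochhammer ℂ k).eval (2 * (a : ℂ) / N) / k.factorial := by
  unfold pochQuot
  push_cast
  congr 1
  induction k with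
  | zero => simp
  | succ k ih =>
    simp only [ascPochhammer_succ_eval]
    push_cast
    rw [ih]

/-- Splitting `δ_i = δ(c_i) + δ(c_{i+1})` and regrouping by entries turns the product over indices
into a product over neighbouring pairs. The conventional `c_0 = 1` gives the outer factor; `c_{d+1}
= 0` gives `x_{k_d}²`, of which the Pochhammer denominator cancels one power. -/
lemma summand_eq {N a : ℕ} (ha : 1 ≤ a) (haN : a ≤ N) {d : ℕ} (c : Fin d → ℕ)
    (z : Fin (d + 1) → ℂ) {k : Fin (d + 1) → ℕ} (hk : Antitone k) :
    summand N a c z k = outerFactor N a (z 0) (k 0) *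
      ((∏ i : Fin d, kernel N a c z i (k i.castSucc) (k i.succ)) *
        ((lin N a (k (Fin.last d)) * pochQuot N a (k (Fin.last d)) : ℝ) : ℂ)) := by
  have hx : ∀ k, (lin N a k : ℂ) ≠ 0 := fun k => by exact_mod_cast (lin_pos ha haN k).ne'
  have hlin : ∀ k : ℕ, (N : ℂ) * k + a = lin N a k := fun k => by simp [lin]
  -- the part of each factor that belongs to the entry on its left, and the one on its right
  let A : Fin (d + 1) → ℂ := fun i => (-1 : ℂ) ^ (k i * delta (extC c i)) *
    (lin N a (k i) : ℂ) ^ delta (extC c i) / (lin N a (k i) : ℂ) /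
      ((lin N a (k i) : ℂ) ^ 2 - z i ^ 2) *
      (W N a (kPrev k i) (k i) (List.replicate (extC c i - 3) 1) : ℂ)
  let B : Fin (d + 1) → ℂ := fun i => (-1 : ℂ) ^ (k i * delta (extC c (i + 1))) *
    (lin N a (k i) : ℂ) ^ delta (extC c (i + 1))
  have hAB : ∀ i : Fin (d + 1), (-1 : ℂ) ^ (k i * deltaI c i) *
      ((N : ℂ) * k i + a) ^ ((deltaI c i : ℤ) - 1) / (((N : ℂ) * k i + a) ^ 2 - z i ^ 2) *
        (W N a (kPrev k i) (k i) (List.replicate (extC c i - 3) 1) : ℂ) = A i * B i := by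
    intro i
    simp only [hlin, A, B, deltaI]
    rw [zpow_sub₀ (hx _), zpow_one, zpow_natCast, mul_add, pow_add, pow_add]
    ring
  -- The convention `k_{-1} = -1` never equals `k_0`, so the outermost `W` is always 2.
  have hW0 : W N a (-1) (k 0) [] = 2 := by
    simp [W, tri_of_ne (show (-1 : ℤ) ≠ k 0 by omega)]
  have hA0 : A 0 = outerFactor N a (z 0) (k 0) := by
    have h := hx (k 0)
    simp only [A, outerFactor, extC, delta, Fin.val_zero, mul_one, pow_one, kPrev, Fin.cases_zero]
    norm_num [hW0]
    field_simp
  have hBl : B (Fin.last d) = (lin N a (k (Fin.last d)) : ℂ) ^ 2 := by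
    simp [B, extC, delta, (even_two.mul_left _).neg_one_pow]
  have hker : ∀ i : Fin d, B i.castSucc * A i.succ =
      kernel N a c z i (k i.castSucc) (k i.succ) := by
    intro i
    have h1 : extC c (i + 1) = c i := by simp [extC]
    have h2 : W N a (k i.castSucc) (k i.succ) (List.replicate (c i - 3) 1) =
        nestedOnes N a (k i.succ) (c i - 3) (k i.castSucc) :=
      W_replicate (hk (Fin.castSucc_lt_succ).le)
    simp only [A, B, kernel, link, Fin.val_castSucc, Fin.val_succ, h1, kPrev, Fin.cases_succ, h2]
    push_cast
    ring
  have := hx (k (Fin.last d))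
  rw [summand, Finset.prod_congr rfl fun i _ => hAB i, hlin, ← div_div, ← pochQuot_cast]
  clear_value A B
  have hprod : ∏ i, A i * B i = outerFactor N a (z 0) (k 0) *
      ((∏ i : Fin d, kernel N a c z i (k i.castSucc) (k i.succ)) *
        (lin N a (k (Fin.last d)) : ℂ) ^ 2) := by
    rw [Finset.prod_mul_distrib, Fin.prod_univ_succ A, Fin.prod_univ_castSucc B, hA0, hBl,
      ← Finset.prod_congr rfl fun i _ => hker i, Finset.prod_mul_distrib]
    ring
  rw [hprod]
  push_cast
  field_simp

lemma sum_tuplesLE_summand {N a : ℕ} (ha : 1 ≤ a) (haN : a ≤ N) {d : ℕ} (c : Fin d → ℕ)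
    (z : Fin (d + 1) → ℂ) (K : ℕ) :
    ∑ k ∈ tuplesLE d K, summand N a c z k = ∑ k ∈ Finset.range (K + 1), outer N a c z k := by
  rw [tuplesLE_eq, Finset.sum_congr rfl fun k hk =>
    summand_eq ha haN c z (mem_antiTuples.1 hk).2]
  exact sum_antiTuples_iterSum (fun k => ((lin N a k * pochQuot N a k : ℝ) : ℂ))
    (kernel N a c z) (outerFactor N a (z 0)) K

lemma sum_antiTuples_norm_summand {N a : ℕ} (ha : 1 ≤ a) (haN : a ≤ N) {d : ℕ} (c : Fin d → ℕ)
    (z : Fin (d + 1) → ℂ) (K : ℕ) :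
    ∑ k ∈ antiTuples (d + 1) K, ‖summand N a c z k‖ =
      ∑ k ∈ Finset.range (K + 1), ‖outerFactor N a (z 0) k‖ *
        iterSum (fun k => lin N a k * pochQuot N a k) d
          (fun i l k => ‖kernel N a c z i l k‖) k := by
  rw [← sum_antiTuples_iterSum]
  refine Finset.sum_congr rfl fun k hk => ?_
  rw [summand_eq ha haN c z (mem_antiTuples.1 hk).2, norm_mul, norm_mul, norm_prod,
    Complex.norm_real, Real.norm_of_nonneg]
  exact mul_nonneg (lin_pos ha haN _).le (pochQuot_nonneg ha haN _)

/-! ### Limit of the coefficients and the Beta function -/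

section limits

variable {N a : ℕ} (ha : 1 ≤ a) (haN : a ≤ N)

include ha haN in
-- Here `x_j² - a² = N j (N j + 2a)` and `x_j = N (a/N + j)`; the initial `a / 2` supplies the
-- factors at `j = 0`.
lemma coeffZero_mul_prod (n : ℕ) :
    coeffZero N a n * (n.factorial * ∏ j ∈ Finset.range (n + 1), (2 * (a / N : ℝ) + j)) =
      N * (∏ j ∈ Finset.range (n + 1), ((a / N : ℝ) + j)) ^ 2 := by
  have hN : (0 : ℝ) < N := by exact_mod_cast ha.trans haN
  have ha' : (0 : ℝ) < a := by exact_mod_cast ha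
  induction n with
  | zero => simp [coeffZero]; field_simp
  | succ n ih =>
    have h0 : lin N a (n + 1) ^ 2 - (a : ℝ) ^ 2 = N * (n + 1) * (N * (n + 1) + 2 * a) := by
      simp only [lin]; push_cast; ring
    have h1 : lin N a (n + 1) = N * (a / N + (n + 1)) := by
      simp only [lin]; push_cast; field_simp; ring
    have h2 : (N : ℝ) * (n + 1) + 2 * a = N * (2 * (a / N) + (n + 1)) := by field_simp; ring
    have h3 : (0 : ℝ) < 2 * (a / N) + (n + 1) := by positivity
    rw [Finset.prod_range_succ, Finset.prod_range_succ _ (n + 1), mul_pow, ← mul_assoc (N : ℝ),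
      ← ih, coeffZero, h0, h2, h1, Nat.factorial_succ]
    push_cast
    field_simp

include ha haN in
lemma coeffZero_eq_gammaSeq {n : ℕ} (hn : n ≠ 0) :
    coeffZero N a n =
      N * Real.GammaSeq (2 * (a / N : ℝ)) n / Real.GammaSeq (a / N : ℝ) n ^ 2 := by
  have hN : (0 : ℝ) < N := by exact_mod_cast ha.trans haN
  have ha' : (0 : ℝ) < a := by exact_mod_cast ha
  have hn' : (0 : ℝ) < n := by exact_mod_cast Nat.pos_of_ne_zero hn
  have hp : ∀ s : ℝ, 0 < s → 0 < ∏ j ∈ Finset.range (n + 1), (s + j) := fun s hs =>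
    Finset.prod_pos fun j _ => by positivity
  have h := coeffZero_mul_prod ha haN n
  have h1 := hp (2 * (a / N)) (by positivity)
  have h2 := hp (a / N) (by positivity)
  have hf : (0 : ℝ) < n.factorial := by positivity
  have hr : (n : ℝ) ^ (2 * (a / N : ℝ)) = ((n : ℝ) ^ (a / N : ℝ)) ^ 2 := by
    rw [mul_comm, Real.rpow_mul hn'.le]; norm_cast
  have hr' : (0 : ℝ) < (n : ℝ) ^ (a / N : ℝ) := Real.rpow_pos_of_pos hn' _
  rw [Real.GammaSeq, Real.GammaSeq, hr]
  generalize ∏ j ∈ Finset.range (n + 1), (2 * (a / N : ℝ) + j) = P at *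
  generalize ∏ j ∈ Finset.range (n + 1), ((a / N : ℝ) + j) = Q at *
  generalize (n : ℝ) ^ (a / N : ℝ) = R at *
  field_simp
  linear_combination h

/-- The limit `N / B(a/N, a/N)` of the partial fraction coefficients, in terms of `Γ`. -/
noncomputable def coeffLim (N a : ℕ) : ℝ :=
  N * Real.Gamma (2 * (a / N : ℝ)) / Real.Gamma (a / N : ℝ) ^ 2

include ha haN in
lemma coeffLim_cast :
    (N : ℂ) / Complex.betaIntegral ((a : ℂ) / N) ((a : ℂ) / N) = (coeffLim N a : ℂ) := by
  have hN : (0 : ℝ) < N := by exact_mod_cast ha.trans haN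
  have ha' : (0 : ℝ) < a := by exact_mod_cast ha
  have hα : (0 : ℝ) < a / N := by positivity
  have hc : ((a : ℂ) / N) = ((a / N : ℝ) : ℂ) := by push_cast; rfl
  have h1 := (Real.Gamma_pos_of_pos hα).ne'
  have h2 := (Real.Gamma_pos_of_pos (show (0 : ℝ) < 2 * (a / N) by positivity)).ne'
  have hb := Complex.Gamma_mul_Gamma_eq_betaIntegral (s := ((a / N : ℝ) : ℂ))
    (t := ((a / N : ℝ) : ℂ)) (by simpa using hα) (by simpa using hα)
  have h3 : ((a / N : ℝ) : ℂ) + ((a / N : ℝ) : ℂ) = ((2 * (a / N : ℝ) : ℝ) : ℂ) := by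
    push_cast; ring
  rw [h3, Complex.Gamma_ofReal, Complex.Gamma_ofReal] at hb
  have h1' : (Real.Gamma (a / N : ℝ) : ℂ) ≠ 0 := by exact_mod_cast h1
  have h2' : (Real.Gamma (2 * (a / N : ℝ)) : ℂ) ≠ 0 := by exact_mod_cast h2
  have hB : Complex.betaIntegral ((a / N : ℝ) : ℂ) ((a / N : ℝ) : ℂ) ≠ 0 := by
    intro h; rw [h, mul_zero] at hb; exact mul_self_ne_zero.2 h1' hb
  have hL : (coeffLim N a : ℂ) =
      N * (Real.Gamma (2 * (a / N : ℝ)) : ℂ) / (Real.Gamma (a / N : ℝ) : ℂ) ^ 2 := by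
    simp only [coeffLim, Complex.ofReal_div, Complex.ofReal_mul, Complex.ofReal_pow,
      Complex.ofReal_natCast]
  rw [hc, hL, div_eq_div_iff hB (pow_ne_zero _ h1')]
  push_cast at hb ⊢
  linear_combination (N : ℂ) * hb

include ha haN in
lemma tendsto_coeffZero : Tendsto (coeffZero N a) atTop (𝓝 (coeffLim N a)) := by
  have hN : (0 : ℝ) < N := by exact_mod_cast ha.trans haN
  have ha' : (0 : ℝ) < a := by exact_mod_cast ha
  have h1 := (Real.Gamma_pos_of_pos (show (0 : ℝ) < a / N by positivity)).ne'
  refine Tendsto.congr' ?_ (((Real.GammaSeq_tendsto_Gamma (2 * (a / N : ℝ))).const_mul (N : ℝ)).div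
    ((Real.GammaSeq_tendsto_Gamma (a / N : ℝ)).pow 2) (pow_ne_zero 2 h1))
  filter_upwards [eventually_ne_atTop 0] with n hn
  exact (coeffZero_eq_gammaSeq ha haN hn).symm

include ha haN in
lemma tendsto_lin : Tendsto (lin N a) atTop atTop := by
  refine tendsto_atTop_mono (fun k => (le_add_of_nonneg_right zero_le_one).trans (le_lin ha haN k))
    tendsto_natCast_atTop_atTop

include ha haN in
-- The quotient of neighbouring coefficients is `1 - (x_k + x_{k+1}) / (x_n + x_{k+1})`, which tends
-- to 1, so the limit does not depend on `k`.
lemma tendsto_coeff (k : ℕ) : Tendsto (fun n => coeff N a n k) atTop (𝓝 (coeffLim N a)) := by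
  induction k with
  | zero => exact tendsto_coeffZero ha haN
  | succ k ih =>
    have hl := tendsto_lin ha haN
    have h1 : Tendsto (fun n => (lin N a k + lin N a (k + 1)) / (lin N a n + lin N a (k + 1)))
        atTop (𝓝 0) :=
      Tendsto.const_div_atTop (tendsto_atTop_add_const_right _ _ hl) _
    have h2 := ih.mul (h1.const_sub 1)
    rw [sub_zero, mul_one] at h2
    refine h2.congr fun n => ?_
    have h3 := lin_pos ha haN n
    have h4 := lin_pos ha haN (k + 1)
    have h5 : lin N a n + lin N a (k + 1) ≠ 0 := by positivity
    simp only [coeff]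
    field_simp
    ring

include ha haN in
/-- A regular summation method: the weighted sums converge when the plain series does. -/
lemma tendsto_sum_coeff_mul {e : ℕ → ℂ} {S : ℂ}
    (h : Tendsto (fun K => ∑ k ∈ Finset.range (K + 1), e k) atTop (𝓝 S)) :
    Tendsto (fun n => ∑ k ∈ Finset.range (n + 1), (coeff N a n k : ℂ) * e k) atTop
      (𝓝 (coeffLim N a * S)) := by
  set s : ℕ → ℂ := fun K => ∑ k ∈ Finset.range (K + 1), e k with hs
  -- Abel summation: the weights become nonnegative differences. Those with `k < K` add up to `coeff
  -- N a n 0 - coeff N a n K`, which tends to 0; beyond `K` the factor `s k - S` is small.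
  have habel : ∀ n, ∑ k ∈ Finset.range (n + 1), (coeff N a n k : ℂ) * e k =
      coeff N a n 0 * S + ∑ k ∈ Finset.range (n + 1),
        ((coeff N a n k - coeff N a n (k + 1) : ℝ) : ℂ) * (s k - S) := by
    intro n
    have H : ∀ K, ∑ k ∈ Finset.range (K + 1), (coeff N a n k : ℂ) * e k =
        coeff N a n 0 * S + ∑ k ∈ Finset.range (K + 1),
          ((coeff N a n k - coeff N a n (k + 1) : ℝ) : ℂ) * (s k - S) +
          coeff N a n (K + 1) * (s K - S) := by
      intro K
      induction K with
      | zero => simp [hs]; ring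
      | succ K ih =>
        rw [Finset.sum_range_succ, ih, Finset.sum_range_succ _ (K + 1)]
        have : s (K + 1) = s K + e (K + 1) := by simp only [hs]; rw [Finset.sum_range_succ]
        rw [this]; push_cast; ring
    rw [H, coeff_eq_zero (Nat.lt_succ_self n)]; simp
  have h0 : Tendsto (fun n => (coeff N a n 0 : ℂ) * S) atTop (𝓝 (coeffLim N a * S)) :=
    ((Complex.continuous_ofReal.tendsto _).comp (tendsto_coeff ha haN 0)).mul_const S
  suffices h1 : Tendsto (fun n => ∑ k ∈ Finset.range (n + 1),
      ((coeff N a n k - coeff N a n (k + 1) : ℝ) : ℂ) * (s k - S)) atTop (𝓝 0) by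
    have := h0.add h1
    rw [add_zero] at this
    exact this.congr fun n => (habel n).symm
  have hd : ∀ n k, 0 ≤ coeff N a n k - coeff N a n (k + 1) := fun n k =>
    sub_nonneg.2 (coeff_succ_le ha haN n k)
  have hz : Tendsto (fun k => s k - S) atTop (𝓝 0) := by simpa using h.sub_const S
  obtain ⟨M, hM⟩ := hz.norm.bddAbove_range
  have hM' : ∀ k, ‖s k - S‖ ≤ M := fun k => hM ⟨k, rfl⟩
  have hM0 : 0 ≤ M := (norm_nonneg _).trans (hM' 0)
  obtain ⟨C, hC⟩ := (tendsto_coeff ha haN 0).bddAbove_range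
  have hC' : ∀ n, coeff N a n 0 ≤ C := fun n => hC ⟨n, rfl⟩
  have hC0 : 0 ≤ C := (coeff_nonneg ha haN 0 0).trans (hC' 0)
  rw [Metric.tendsto_atTop]
  intro ε hε
  obtain ⟨K, hK⟩ := Metric.tendsto_atTop.1 hz (ε / (2 * (C + 1))) (by positivity)
  have h2 : Tendsto (fun n => M * (coeff N a n 0 - coeff N a n K)) atTop (𝓝 0) := by
    simpa using ((tendsto_coeff ha haN 0).sub (tendsto_coeff ha haN K)).const_mul M
  obtain ⟨n₀, hn₀⟩ := Metric.tendsto_atTop.1 h2 (ε / 2) (by positivity)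
  refine ⟨max n₀ K, fun n hn => ?_⟩
  have hb : M * (coeff N a n 0 - coeff N a n K) < ε / 2 := by
    have := hn₀ n (le_of_max_le_left hn)
    rw [Real.dist_0_eq_abs] at this
    exact (le_abs_self _).trans_lt this
  have hKn : K ≤ n := le_of_max_le_right hn
  rw [dist_zero_right]
  have hterm : ∀ k, ‖((coeff N a n k - coeff N a n (k + 1) : ℝ) : ℂ) * (s k - S)‖ =
      (coeff N a n k - coeff N a n (k + 1)) * ‖s k - S‖ := fun k => by
    rw [norm_mul, Complex.norm_real, Real.norm_of_nonneg (hd n k)]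
  calc _ ≤ ∑ k ∈ Finset.range (n + 1), (coeff N a n k - coeff N a n (k + 1)) * ‖s k - S‖ := by
        refine (norm_sum_le _ _).trans (Finset.sum_le_sum fun k _ => (hterm k).le)
    _ ≤ ∑ k ∈ Finset.range K, (coeff N a n k - coeff N a n (k + 1)) * M +
        ∑ k ∈ Finset.range (n + 1),
          (coeff N a n k - coeff N a n (k + 1)) * (ε / (2 * (C + 1))) := by
        have hsub : Finset.range K ⊆ Finset.range (n + 1) := by
          intro x; simp only [Finset.mem_range]; omega
        rw [← Finset.sum_sdiff hsub, add_comm]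
        refine add_le_add (Finset.sum_le_sum fun k _ => ?_) (le_trans (Finset.sum_le_sum
          fun k hk => ?_) (Finset.sum_le_sum_of_subset_of_nonneg (Finset.sdiff_subset)
            fun k _ _ => mul_nonneg (hd n k) (by positivity)))
        · exact mul_le_mul_of_nonneg_left (hM' k) (hd n k)
        · simp only [Finset.mem_sdiff, Finset.mem_range, not_lt] at hk
          have := (hK k hk.2).le
          rw [dist_zero_right] at this
          exact mul_le_mul_of_nonneg_left this (hd n k)
    _ = M * (coeff N a n 0 - coeff N a n K) + coeff N a n 0 * (ε / (2 * (C + 1))) := by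
        rw [← Finset.sum_mul, ← Finset.sum_mul, Finset.sum_range_sub', Finset.sum_range_sub',
          coeff_eq_zero (Nat.lt_succ_self n)]
        ring
    _ < ε / 2 + ε / 2 := by
        refine add_lt_add_of_lt_of_le hb ?_
        have h3 : coeff N a n 0 ≤ C + 1 := (hC' n).trans (by linarith)
        calc _ ≤ (C + 1) * (ε / (2 * (C + 1))) := by gcongr
          _ = ε / 2 := by field_simp
    _ = ε := by ring

end limits

/-! ### Logarithmic bounds and absolute convergence -/

/-- The shifted harmonic sum `1 + ∑_{l ≤ k} 1 / (N l + a)`. -/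
noncomputable def harm (N a k : ℕ) : ℝ := 1 + ∑ l ∈ Finset.range (k + 1), 1 / lin N a l

section bounds

variable {N a : ℕ} (ha : 1 ≤ a) (haN : a ≤ N)

include ha haN in
lemma harm_mono : Monotone (harm N a) := fun k l h => by
  unfold harm
  refine add_le_add_right (Finset.sum_le_sum_of_subset_of_nonneg (fun x => ?_) fun i _ _ =>
    (one_div_pos.2 (lin_pos ha haN i)).le) _
  simp only [Finset.mem_range]; omega

include ha haN in
lemma one_le_harm (k : ℕ) : 1 ≤ harm N a k :=
  le_add_of_nonneg_right (Finset.sum_nonneg fun i _ => (one_div_pos.2 (lin_pos ha haN i)).le)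

lemma sum_le_harm (k : ℕ) : ∑ l ∈ Finset.range (k + 1), 1 / lin N a l ≤ harm N a k := by
  unfold harm; linarith

lemma two_pow_tri_le (k m : ℤ) : (2 : ℝ) ^ tri k m ≤ 2 := by
  unfold tri; split_ifs <;> norm_num

include ha haN in
lemma nestedOnes_nonneg (m u k : ℕ) : 0 ≤ nestedOnes N a m u k := by
  induction u generalizing k with
  | zero => simp only [nestedOnes]; positivity
  | succ u ih =>
    refine Finset.sum_nonneg fun l _ => mul_nonneg ?_ (ih l)
    have := lin_pos ha haN l
    positivity

include ha haN in
lemma nestedOnes_le (m u k : ℕ) : nestedOnes N a m u k ≤ 2 ^ (u + 1) * harm N a k ^ u := by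
  induction u generalizing k with
  | zero => simpa [nestedOnes] using two_pow_tri_le k m
  | succ u ih =>
    have hk := one_le_harm ha haN k
    have hsub : Finset.Icc m k ⊆ Finset.range (k + 1) := fun x => by
      simp only [Finset.mem_Icc, Finset.mem_range]; omega
    have hpos : ∀ l, 0 ≤ 1 / lin N a l := fun l => (one_div_pos.2 (lin_pos ha haN l)).le
    calc nestedOnes N a m (u + 1) k ≤ ∑ l ∈ Finset.Icc m k,
          2 ^ (u + 2) * harm N a k ^ u * (1 / lin N a l) := by
          refine Finset.sum_le_sum fun l hl => ?_
          have h1 : harm N a l ≤ harm N a k := harm_mono ha haN (Finset.mem_Icc.1 hl).2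
          have h0 := one_le_harm ha haN l
          have h2 : nestedOnes N a m u l ≤ 2 ^ (u + 1) * harm N a k ^ u :=
            (ih l).trans (by gcongr)
          have h3 := two_pow_tri_le k l
          have h4 := lin_pos ha haN l
          have h5 := nestedOnes_nonneg ha haN m u l
          calc _ ≤ 2 / lin N a l * (2 ^ (u + 1) * harm N a k ^ u) := by gcongr
            _ = _ := by ring
      _ ≤ ∑ l ∈ Finset.range (k + 1), 2 ^ (u + 2) * harm N a k ^ u * (1 / lin N a l) :=
          Finset.sum_le_sum_of_subset_of_nonneg hsub fun l _ _ =>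
            mul_nonneg (by positivity) (hpos l)
      _ ≤ 2 ^ (u + 2) * harm N a k ^ u * harm N a k := by
          rw [← Finset.mul_sum]
          exact mul_le_mul_of_nonneg_left (sum_le_harm k) (by positivity)
      _ = _ := by ring

include ha haN in
-- As `x_k ≥ 1`, one has `x_k² - |z|² ≥ x_k² (1 - |z|²)`.
lemma exists_inv_norm_le {z : ℂ} (hz : ‖z‖ < 1) :
    ∃ κ : ℝ, 0 ≤ κ ∧ ∀ k, 1 / ‖(lin N a k : ℂ) ^ 2 - z ^ 2‖ ≤ κ / lin N a k ^ 2 := by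
  have h0 := norm_nonneg z
  have h1 : 0 < 1 - ‖z‖ ^ 2 := by nlinarith
  refine ⟨1 / (1 - ‖z‖ ^ 2), by positivity, fun k => ?_⟩
  have h2 := one_le_lin ha haN k
  have h3 : lin N a k ^ 2 * (1 - ‖z‖ ^ 2) ≤ ‖(lin N a k : ℂ) ^ 2 - z ^ 2‖ := by
    have := norm_sub_norm_le ((lin N a k : ℂ) ^ 2) (z ^ 2)
    rw [norm_pow, norm_pow, Complex.norm_real, Real.norm_of_nonneg (by linarith)] at this
    have h4 : 1 ≤ lin N a k ^ 2 := by nlinarith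
    nlinarith [sq_nonneg ‖z‖]
  rw [div_div, mul_comm]
  exact one_div_le_one_div_of_le (by positivity) h3

lemma abs_link (c l k : ℕ) : |link N a c l k| =
    |lin N a l| ^ delta c * (|lin N a k| ^ delta c / |lin N a k|) *
      |nestedOnes N a k (c - 3) l| := by
  simp [link, abs_mul, abs_div, abs_pow]

include ha haN in
lemma abs_link_one_le (l k : ℕ) : |link N a 1 l k| ≤ 2 * lin N a l := by
  have hl := lin_pos ha haN l
  have hk := lin_pos ha haN k
  have h : nestedOnes N a k (1 - 3) l = 2 ^ tri l k := rfl
  rw [abs_link, h, abs_of_pos hl, abs_of_pos hk, abs_of_nonneg (by positivity)]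
  simp only [delta, pow_one, div_self hk.ne', mul_one]
  rw [mul_comm]
  exact mul_le_mul_of_nonneg_right (two_pow_tri_le _ _) hl.le

include ha haN in
lemma abs_link_le {c : ℕ} (hc : 3 ≤ c) (l k : ℕ) :
    |link N a c l k| ≤ 2 ^ (c - 2) * harm N a l ^ (c - 3) * (1 / lin N a k) := by
  have hk := lin_pos ha haN k
  have hd : delta c = 0 := by
    obtain ⟨u, rfl⟩ := Nat.exists_eq_add_of_le' hc; rfl
  have h := nestedOnes_le ha haN k (c - 3) l
  rw [show c - 3 + 1 = c - 2 by omega] at h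
  rw [abs_link, hd, abs_of_pos hk, abs_of_nonneg (nestedOnes_nonneg ha haN _ _ _)]
  simp only [pow_zero, one_mul]
  rw [mul_comm]
  gcongr

lemma norm_kernel {d : ℕ} (c : Fin d → ℕ) (z : Fin (d + 1) → ℂ) (i : Fin d) (l k : ℕ) :
    ‖kernel N a c z i l k‖ =
      |link N a (c i) l k| * (1 / ‖(lin N a k : ℂ) ^ 2 - z i.succ ^ 2‖) := by
  rw [kernel, norm_div, Complex.norm_real, Real.norm_eq_abs, div_eq_mul_one_div]

/-- The nested sum of the absolute values. -/
noncomputable def absInner (N a : ℕ) {d : ℕ} (c : Fin d → ℕ) (z : Fin (d + 1) → ℂ) (k : ℕ) : ℝ :=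
  iterSum (fun k => lin N a k * pochQuot N a k) d (fun i l k => ‖kernel N a c z i l k‖) k

lemma absInner_zero (c : Fin 0 → ℕ) (z : Fin 1 → ℂ) (k : ℕ) :
    absInner N a c z k = lin N a k * pochQuot N a k := rfl

lemma absInner_succ {d : ℕ} (c : Fin (d + 1) → ℕ) (z : Fin (d + 2) → ℂ) (k : ℕ) :
    absInner N a c z k = ∑ l ∈ Finset.range (k + 1),
      ‖kernel N a c z 0 k l‖ * absInner N a (Fin.tail c) (Fin.tail z) l := rfl

include ha haN in
lemma absInner_nonneg {d : ℕ} (c : Fin d → ℕ) (z : Fin (d + 1) → ℂ) (k : ℕ) :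
    0 ≤ absInner N a c z k := by
  induction d generalizing k with
  | zero => exact mul_nonneg (lin_pos ha haN k).le (pochQuot_nonneg ha haN k)
  | succ d ih =>
    rw [absInner_succ]
    exact Finset.sum_nonneg fun l _ => mul_nonneg (norm_nonneg _) (ih _ _ l)

include ha haN in
-- The kernel is of size `x_l^{-3}` up to powers of `harm`, so growth `x_l²` leaves a harmonic sum:
-- an entry at least 3 reduces quadratic to logarithmic growth.
lemma absInner_le_of_three_le {d : ℕ} {c : Fin (d + 1) → ℕ} (hc : 3 ≤ c 0)
    {z : Fin (d + 2) → ℂ} (hz : ‖z 1‖ < 1) {M : ℝ} {q : ℕ} (hM : 0 ≤ M)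
    (h : ∀ k, absInner N a (Fin.tail c) (Fin.tail z) k ≤ M * lin N a k ^ 2 * harm N a k ^ q) :
    ∃ (M' : ℝ) (q' : ℕ), 0 ≤ M' ∧ ∀ k, absInner N a c z k ≤ M' * harm N a k ^ q' := by
  obtain ⟨κ, hκ, hκ'⟩ := exists_inv_norm_le ha haN hz
  refine ⟨2 ^ (c 0 - 2) * κ * M, (c 0 - 3) + q + 1, by positivity, fun k => ?_⟩
  have hk := one_le_harm ha haN k
  calc absInner N a c z k ≤ ∑ l ∈ Finset.range (k + 1),
        2 ^ (c 0 - 2) * κ * M * harm N a k ^ (c 0 - 3) * harm N a k ^ q * (1 / lin N a l) := by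
        rw [absInner_succ]
        refine Finset.sum_le_sum fun l hl => ?_
        have hlk : harm N a l ≤ harm N a k :=
          harm_mono ha haN (by simp only [Finset.mem_range] at hl; omega)
        have h0 := one_le_harm ha haN l
        have hl0 := lin_pos ha haN l
        rw [norm_kernel]
        calc _ ≤ (2 ^ (c 0 - 2) * harm N a k ^ (c 0 - 3) * (1 / lin N a l)) *
              (κ / lin N a l ^ 2) * (M * lin N a l ^ 2 * harm N a k ^ q) := by
              refine mul_le_mul_of_nonneg' (mul_le_mul_of_nonneg' (abs_link_le ha haN hc k l)
                (hκ' l) (by positivity) (by positivity)) ((h l).trans ?_) ?_ (by positivity)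
              · gcongr
              · exact absInner_nonneg ha haN _ _ l
          _ = _ := by field_simp
    _ ≤ 2 ^ (c 0 - 2) * κ * M * harm N a k ^ (c 0 - 3) * harm N a k ^ q * harm N a k := by
        rw [← Finset.mul_sum]
        exact mul_le_mul_of_nonneg_left (sum_le_harm k) (by positivity)
    _ = _ := by ring

include ha haN in
-- The kernel is at most a constant times `x_k / x_l²`; the `k + 1 ≤ x_k` terms each contribute
-- order `x_k` up to powers of `harm`, so quadratic growth is preserved.
lemma absInner_le_of_eq_one {d : ℕ} {c : Fin (d + 1) → ℕ} (hc : c 0 = 1)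
    {z : Fin (d + 2) → ℂ} (hz : ‖z 1‖ < 1) {M : ℝ} {q : ℕ} (hM : 0 ≤ M)
    (h : ∀ k, absInner N a (Fin.tail c) (Fin.tail z) k ≤ M * lin N a k ^ 2 * harm N a k ^ q) :
    ∃ (M' : ℝ) (q' : ℕ), 0 ≤ M' ∧
      ∀ k, absInner N a c z k ≤ M' * lin N a k ^ 2 * harm N a k ^ q' := by
  obtain ⟨κ, hκ, hκ'⟩ := exists_inv_norm_le ha haN hz
  refine ⟨2 * κ * M, q, by positivity, fun k => ?_⟩
  have hk := one_le_harm ha haN k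
  have hk0 := lin_pos ha haN k
  calc absInner N a c z k ≤ ∑ l ∈ Finset.range (k + 1),
        2 * κ * M * lin N a k * harm N a k ^ q := by
        rw [absInner_succ]
        refine Finset.sum_le_sum fun l hl => ?_
        have hlk : harm N a l ≤ harm N a k :=
          harm_mono ha haN (by simp only [Finset.mem_range] at hl; omega)
        have h0 := one_le_harm ha haN l
        have hl0 := lin_pos ha haN l
        rw [norm_kernel, hc]
        calc _ ≤ (2 * lin N a k) * (κ / lin N a l ^ 2) *
              (M * lin N a l ^ 2 * harm N a k ^ q) := by
              refine mul_le_mul_of_nonneg' (mul_le_mul_of_nonneg' (abs_link_one_le ha haN k l)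
                (hκ' l) (by positivity) (by positivity)) ((h l).trans ?_) ?_ (by positivity)
              · gcongr
              · exact absInner_nonneg ha haN _ _ l
          _ = _ := by field_simp
    _ = 2 * κ * M * lin N a k * harm N a k ^ q * (k + 1) := by
        rw [Finset.sum_const, Finset.card_range, nsmul_eq_mul]; push_cast; ring
    _ ≤ 2 * κ * M * lin N a k * harm N a k ^ q * lin N a k :=
        mul_le_mul_of_nonneg_left (le_lin ha haN k) (by positivity)
    _ = _ := by ring

include ha haN in
lemma exists_absInner_le {d : ℕ} {c : Fin d → ℕ} (hc : ∀ j, 1 ≤ c j ∧ c j ≠ 2)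
    {z : Fin (d + 1) → ℂ} (hz : ∀ j, ‖z j‖ < 1) :
    ∃ (M : ℝ) (q : ℕ), 0 ≤ M ∧
      ∀ k, absInner N a c z k ≤ M * lin N a k ^ 2 * harm N a k ^ q := by
  induction d with
  | zero =>
    refine ⟨1, 0, zero_le_one, fun k => ?_⟩
    have hk := lin_pos ha haN k
    rw [absInner_zero]
    have := (pochQuot_le ha haN k).trans (le_lin ha haN k)
    nlinarith
  | succ d ih =>
    obtain ⟨M, q, hM, h⟩ := ih (c := Fin.tail c) (fun j => hc j.succ) (z := Fin.tail z)
      (fun j => hz j.succ)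
    obtain h1 | h3 : c 0 = 1 ∨ 3 ≤ c 0 := by have := hc 0; omega
    · exact absInner_le_of_eq_one ha haN h1 (hz 1) hM h
    · obtain ⟨M', q', hM', h'⟩ := absInner_le_of_three_le ha haN h3 (hz 1) hM h
      refine ⟨M', q', hM', fun k => (h' k).trans ?_⟩
      have h0 := one_le_harm ha haN k
      have hk := one_le_lin ha haN k
      have : 1 ≤ lin N a k ^ 2 := one_le_pow₀ hk
      gcongr
      exact le_mul_of_one_le_right hM' this

include ha haN in
lemma harm_le_log (k : ℕ) : harm N a k ≤ 2 + Real.log ((k : ℝ) + 1) := by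
  have h := harmonic_le_one_add_log (k + 1)
  have h1 : ∑ l ∈ Finset.range (k + 1), 1 / lin N a l ≤ (harmonic (k + 1) : ℝ) := by
    simp only [harmonic]
    push_cast
    refine Finset.sum_le_sum fun l _ => ?_
    rw [one_div]
    exact inv_anti₀ (by positivity) (le_lin ha haN l)
  unfold harm
  push_cast at h
  linarith

include ha haN in
lemma summable_harm_pow_div (q : ℕ) : Summable fun k => harm N a k ^ q / lin N a k ^ 2 := by
  -- Chosen so that `ε q ≤ 1/2`, also for `q = 0`; the terms are then of order `k^{-3/2}`.
  set ε : ℝ := 1 / (2 * (q + 1)) with hε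
  have hε0 : 0 < ε := by positivity
  have hs : Summable fun k : ℕ => (2 + 1 / ε) ^ q * (((k + 1 : ℕ) : ℝ) ^ (-(3 / 2) : ℝ)) :=
    ((summable_nat_add_iff 1).2 (Real.summable_nat_rpow.2 (by norm_num))).mul_left _
  refine Summable.of_nonneg_of_le (fun k => ?_) (fun k => ?_) hs
  · have := one_le_harm ha haN k; positivity
  have hh := one_le_harm ha haN k
  have hk0 : (0 : ℝ) < (k : ℝ) + 1 := by positivity
  have hk1 : (1 : ℝ) ≤ (k : ℝ) + 1 := by linarith [k.cast_nonneg (α := ℝ)]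
  have hle : harm N a k ≤ (2 + 1 / ε) * ((k : ℝ) + 1) ^ ε := by
    have h1 := Real.log_le_rpow_div hk0.le hε0
    have h2 : 1 ≤ ((k : ℝ) + 1) ^ ε := Real.one_le_rpow hk1 hε0.le
    have h3 := harm_le_log ha haN k
    have h4 : (2 + 1 / ε) * ((k : ℝ) + 1) ^ ε =
      2 * ((k : ℝ) + 1) ^ ε + ((k : ℝ) + 1) ^ ε / ε := by ring
    linarith
  have hpow : harm N a k ^ q ≤ (2 + 1 / ε) ^ q * ((k : ℝ) + 1) ^ (1 / 2 : ℝ) := by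
    calc _ ≤ ((2 + 1 / ε) * ((k : ℝ) + 1) ^ ε) ^ q := by gcongr
      _ = (2 + 1 / ε) ^ q * ((k : ℝ) + 1) ^ (ε * q) := by
        rw [mul_pow, Real.rpow_mul hk0.le, Real.rpow_natCast]
      _ ≤ _ := by
        gcongr
        rw [hε, div_mul_eq_mul_div, div_le_div_iff₀ (by positivity) (by norm_num)]; linarith
  calc _ ≤ (2 + 1 / ε) ^ q * ((k : ℝ) + 1) ^ (1 / 2 : ℝ) / ((k : ℝ) + 1) ^ 2 := by
        have := le_lin ha haN k
        gcongr
    _ = _ := by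
        push_cast
        rw [mul_div_assoc, ← Real.rpow_natCast ((k : ℝ) + 1) 2, ← Real.rpow_sub hk0]
        norm_num

include ha haN in
lemma summable_norm_outerFactor_mul {d : ℕ} (hd : 0 < d) {c : Fin d → ℕ}
    (hc : ∀ j, 1 ≤ c j ∧ c j ≠ 2) (hc1 : 3 ≤ c ⟨0, hd⟩) {z : Fin (d + 1) → ℂ}
    (hz : ∀ j, ‖z j‖ < 1) :
    Summable fun k => ‖outerFactor N a (z 0) k‖ * absInner N a c z k := by
  obtain ⟨d, rfl⟩ := Nat.exists_eq_succ_of_ne_zero hd.ne'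
  obtain ⟨M, q, hM, h⟩ := exists_absInner_le ha haN (c := Fin.tail c) (fun j => hc j.succ)
    (z := Fin.tail z) (fun j => hz j.succ)
  obtain ⟨M', q', hM', h'⟩ := absInner_le_of_three_le ha haN hc1 (hz 1) hM h
  obtain ⟨κ, hκ, hκ'⟩ := exists_inv_norm_le ha haN (hz 0)
  refine Summable.of_norm_bounded ((summable_harm_pow_div ha haN q').mul_left (2 * κ * M'))
    fun k => ?_
  have h0 := absInner_nonneg ha haN c z k
  have hf : ‖outerFactor N a (z 0) k‖ ≤ 2 * (κ / lin N a k ^ 2) := by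
    rw [outerFactor, norm_div, div_eq_mul_one_div]
    simpa using hκ' k
  rw [Real.norm_of_nonneg (mul_nonneg (norm_nonneg _) h0)]
  calc _ ≤ 2 * (κ / lin N a k ^ 2) * (M' * harm N a k ^ q') := by
        gcongr
        exact h' k
    _ = _ := by ring

include ha haN in
lemma norm_inner_le {d : ℕ} (c : Fin d → ℕ) (z : Fin (d + 1) → ℂ) (k : ℕ) :
    ‖inner N a c z k‖ ≤ absInner N a c z k := by
  induction d generalizing k with
  | zero =>
    rw [inner_zero, absInner_zero, Complex.norm_real, Real.norm_of_nonneg]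
    exact mul_nonneg (lin_pos ha haN k).le (pochQuot_nonneg ha haN k)
  | succ d ih =>
    rw [absInner_succ]
    have h : inner N a c z k = ∑ l ∈ Finset.range (k + 1),
      kernel N a c z 0 k l * inner N a (Fin.tail c) (Fin.tail z) l := rfl
    rw [h]
    refine (norm_sum_le _ _).trans (Finset.sum_le_sum fun l _ => ?_)
    rw [norm_mul]
    exact mul_le_mul_of_nonneg_left (ih _ _ l) (norm_nonneg _)

end bounds

/-! ### Conditional convergence for `d = 0` -/

section depthZero

variable {N a : ℕ} (ha : 1 ≤ a) (haN : a ≤ N)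

lemma pochQuot_eq_prod (N a k : ℕ) :
    pochQuot N a k = (∏ j ∈ Finset.range k, (2 * (a / N : ℝ) + j)) / k.factorial := by
  have h : 2 * (a : ℝ) / N = 2 * (a / N : ℝ) := by ring
  rw [pochQuot, h]
  congr 1
  induction k with
  | zero => simp
  | succ k ih => rw [ascPochhammer_succ_eval, Finset.prod_range_succ, ih]

include ha haN in
lemma pochQuot_mul_gammaSeq {k : ℕ} :
    pochQuot N a k * (2 * (a / N : ℝ) + k) * Real.GammaSeq (2 * (a / N : ℝ)) k =
      (k : ℝ) ^ (2 * (a / N : ℝ)) := by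
  have hN : (0 : ℝ) < N := by exact_mod_cast ha.trans haN
  have ha' : (0 : ℝ) < a := by exact_mod_cast ha
  have hp : 0 < ∏ j ∈ Finset.range k, (2 * (a / N : ℝ) + j) :=
    Finset.prod_pos fun j _ => by positivity
  have hk : (0 : ℝ) < 2 * (a / N : ℝ) + k := by positivity
  have hf : (0 : ℝ) < k.factorial := by positivity
  rw [Real.GammaSeq, Finset.prod_range_succ, pochQuot_eq_prod]
  generalize ∏ j ∈ Finset.range k, (2 * (a / N : ℝ) + j) = P at *
  generalize (k : ℝ) ^ (2 * (a / N : ℝ)) = R at *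
  generalize 2 * (a / N : ℝ) + k = Q at *
  field_simp

include ha haN in
lemma antitone_pochQuot_div : Antitone fun k => pochQuot N a k / lin N a k := by
  refine antitone_nat_of_succ_le fun k => ?_
  have hN : (0 : ℝ) < N := by exact_mod_cast ha.trans haN
  have haN' : (a : ℝ) ≤ N := by exact_mod_cast haN
  have h0 := lin_pos ha haN k
  have h1 := lin_pos ha haN (k + 1)
  have hp : 0 < lin N a (k + 1) - a := by rw [lin]; push_cast; ring_nf; positivity
  have h := pochQuot_succ ha haN k
  have hq := pochQuot_nonneg ha haN k
  rw [div_le_div_iff₀ h1 h0, ← mul_le_mul_iff_left₀ hp]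
  calc pochQuot N a (k + 1) * lin N a k * (lin N a (k + 1) - a)
      = pochQuot N a k * ((lin N a k + a) * lin N a k) := by linear_combination lin N a k * h
    _ ≤ pochQuot N a k * (lin N a (k + 1) * (lin N a (k + 1) - a)) := by
        refine mul_le_mul_of_nonneg_left ?_ hq
        rw [lin_succ]
        nlinarith
    _ = _ := by ring

include ha in
-- By the Gamma limit the quotient has order `k^{2a/N - 2}`, so it decays because `a < N`; for `a =
-- N` it would not.
lemma tendsto_pochQuot_div (haN : a < N) :
    Tendsto (fun k => pochQuot N a k / lin N a k) atTop (𝓝 0) := by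
  have hN : (0 : ℝ) < N := by exact_mod_cast ha.trans haN.le
  have ha' : (0 : ℝ) < a := by exact_mod_cast ha
  have hα1 : (a / N : ℝ) < 1 := by rw [div_lt_one hN]; exact_mod_cast haN
  have hs : (0 : ℝ) < 2 * (a / N : ℝ) := by positivity
  have hΓ := Real.Gamma_pos_of_pos hs
  have h1 : Tendsto (fun k : ℕ => (k : ℝ) ^ (-(2 - 2 * (a / N : ℝ)))) atTop (𝓝 0) :=
    (tendsto_rpow_neg_atTop (by linarith)).comp tendsto_natCast_atTop_atTop
  have h2 := h1.div (Real.GammaSeq_tendsto_Gamma (2 * (a / N : ℝ))) hΓ.ne'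
  rw [zero_div] at h2
  refine squeeze_zero' (Eventually.of_forall fun k => div_nonneg (pochQuot_nonneg ha haN.le k)
    (lin_pos ha haN.le k).le) ?_ h2
  filter_upwards [eventually_gt_atTop 0,
    (Real.GammaSeq_tendsto_Gamma (2 * (a / N : ℝ))).eventually_const_lt hΓ] with k hk hG
  have hk' : (0 : ℝ) < k := by exact_mod_cast hk
  have h3 := pochQuot_mul_gammaSeq ha haN.le (k := k)
  have h4 : (k : ℝ) ≤ lin N a k := by linarith [le_lin ha haN.le k]
  have hp := pochQuot_nonneg ha haN.le k
  rw [Pi.div_apply, neg_sub, Real.rpow_sub hk', ← h3]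
  have h5 : (k : ℝ) ^ (2 : ℝ) = k ^ 2 := by norm_cast
  rw [h5, le_div_iff₀ hG, mul_comm, mul_comm _ (Real.GammaSeq _ _), mul_div_assoc]
  refine mul_le_mul_of_nonneg_left ?_ hG.le
  rw [div_le_div_iff₀ (lin_pos ha haN.le k) (by positivity)]
  have h6 : (k : ℝ) ^ 2 ≤ (2 * (a / N : ℝ) + k) * lin N a k := by nlinarith
  calc _ ≤ pochQuot N a k * ((2 * (a / N : ℝ) + k) * lin N a k) :=
        mul_le_mul_of_nonneg_left h6 hp
    _ = _ := by ring

include ha in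
-- From `x² / (x² - z²) = 1 + z² / (x² - z²)` the series splits into a Leibniz series and an
-- absolutely convergent correction.
lemma exists_tendsto_sum_outer_zero (haN : a < N) (c : Fin 0 → ℕ) {z : Fin 1 → ℂ}
    (hz : ‖z 0‖ < 1) :
    ∃ S, Tendsto (fun K => ∑ k ∈ Finset.range K, outer N a c z k) atTop (𝓝 S) := by
  obtain ⟨l, hl⟩ := (antitone_pochQuot_div ha haN.le).tendsto_alternating_series_of_tendsto_zero
    (tendsto_pochQuot_div ha haN)
  obtain ⟨κ, hκ, hκ'⟩ := exists_inv_norm_le ha haN.le hz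
  have hs : Summable fun k => (-1 : ℂ) ^ k * (pochQuot N a k / lin N a k : ℝ) *
      (z 0 ^ 2 / ((lin N a k : ℂ) ^ 2 - z 0 ^ 2)) := by
    refine Summable.of_norm_bounded (g := fun k => ‖z 0‖ ^ 2 * κ * (harm N a k ^ 0 / lin N a k ^ 2))
      ((summable_harm_pow_div ha haN.le 0).mul_left _) fun k => ?_
    have h0 := lin_pos ha haN.le k
    have h1 : pochQuot N a k / lin N a k ≤ 1 :=
      (div_le_one h0).2 ((pochQuot_le ha haN.le k).trans (le_lin ha haN.le k))
    have h2 : 0 ≤ pochQuot N a k / lin N a k := div_nonneg (pochQuot_nonneg ha haN.le k) h0.le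
    rw [norm_mul, norm_mul, norm_pow, norm_neg, norm_one, one_pow, one_mul, Complex.norm_real,
      Real.norm_of_nonneg h2, norm_div, norm_pow, div_eq_mul_one_div (‖z 0‖ ^ 2)]
    calc _ ≤ 1 * (‖z 0‖ ^ 2 * (κ / lin N a k ^ 2)) :=
          mul_le_mul h1 (mul_le_mul_of_nonneg_left (hκ' k) (by positivity)) (by positivity)
            zero_le_one
      _ = _ := by ring
  have hl' : Tendsto (fun n => ((∑ i ∈ Finset.range n, (-1) ^ i *
      (pochQuot N a i / lin N a i) : ℝ) : ℂ)) atTop (𝓝 (l : ℂ)) :=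
    (Complex.continuous_ofReal.tendsto l).comp hl
  obtain ⟨T, hT⟩ := hs
  refine ⟨2 * (l + T), ((hl'.add hT.tendsto_sum_nat).const_mul 2).congr fun K => ?_⟩
  push_cast
  rw [← Finset.sum_add_distrib, Finset.mul_sum]
  refine Finset.sum_congr rfl fun k _ => ?_
  have h0 : (lin N a k : ℂ) ≠ 0 := by exact_mod_cast (lin_pos ha haN.le k).ne'
  have h1 := lin_sq_sub_ne_zero ha haN.le hz k
  rw [outer, inner_zero]
  push_cast
  field_simp
  ring

end depthZero

/-! ### Passage to the limit -/

section main

variable {N a d : ℕ} (ha : 1 ≤ a) (haN : a ≤ N) {c : Fin d → ℕ}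
  (hc : ∀ j, 1 ≤ c j ∧ c j ≠ 2) (hc1 : ∀ h : 0 < d, 3 ≤ c ⟨0, h⟩) (hd : 1 ≤ d ∨ a < N)

include ha haN hc hc1 hd

lemma exists_tendsto_sum_outer {z : Fin (d + 1) → ℂ} (hz : ∀ j, ‖z j‖ < 1) :
    ∃ S, Tendsto (fun K => ∑ k ∈ Finset.range (K + 1), outer N a c z k) atTop (𝓝 S) := by
  suffices h : ∃ S, Tendsto (fun K => ∑ k ∈ Finset.range K, outer N a c z k) atTop (𝓝 S) by
    obtain ⟨S, hS⟩ := h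
    exact ⟨S, hS.comp (tendsto_add_atTop_nat 1)⟩
  rcases Nat.eq_zero_or_pos d with rfl | hd0
  · exact exists_tendsto_sum_outer_zero ha (by omega) c (hz 0)
  · have hs : Summable (outer N a c z) :=
      Summable.of_norm_bounded (summable_norm_outerFactor_mul ha haN hd0 hc (hc1 hd0) hz)
        fun k => by
          have h : outer N a c z k = outerFactor N a (z 0) k * inner N a c z k := rfl
          rw [h, norm_mul]
          exact mul_le_mul_of_nonneg_left (norm_inner_le ha haN c z k) (norm_nonneg _)
    exact ⟨_, hs.hasSum.tendsto_sum_nat⟩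

omit ha haN hd hc hc1 in
lemma tStarTerm_nonneg (s : List ℕ) (k : Fin s.length → ℕ) : 0 ≤ tStarTerm N a s k :=
  Finset.prod_nonneg fun i _ => by positivity

omit ha haN hd hc hc1 in
lemma tTrunc_nonneg (s : List ℕ) (n : ℕ) : 0 ≤ tTrunc N a s n := by
  rw [← sum_antiTuples_tStarTerm]
  exact Finset.sum_nonneg fun k _ => tStarTerm_nonneg s k

/-- All terms are nonnegative, so a partial sum is at most the full series at level `n`. By the
finite identity that is `finiteSum`, which converges in `n` and is therefore bounded. -/
lemma exists_sum_tTrunc_le {ρ : Fin (d + 1) → ℝ} (h0 : ∀ j, 0 ≤ ρ j) (h1 : ∀ j, ρ j < 1) :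
    ∃ M, ∀ (u : Finset (Fin (d + 1) → ℕ)) (n : ℕ),
      ∑ b ∈ u, tTrunc N a (blockIndex c b) n * ∏ j, ρ j ^ (2 * b j) ≤ M := by
  have hz : ∀ j, ‖((ρ j : ℝ) : ℂ)‖ < 1 := fun j => by
    rw [Complex.norm_real, Real.norm_of_nonneg (h0 j)]; exact h1 j
  obtain ⟨S, hS⟩ := exists_tendsto_sum_outer ha haN hc hc1 hd hz
  obtain ⟨M, hM⟩ := (tendsto_sum_coeff_mul ha haN hS).norm.bddAbove_range
  refine ⟨M, fun u n => ?_⟩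
  have h := Complex.reCLM.hasSum (hasSum_truncTerm ha haN hc hz n)
  have hre : ∀ b, Complex.reCLM (truncTerm N a c (fun j => ((ρ j : ℝ) : ℂ)) n b) =
      tTrunc N a (blockIndex c b) n * ∏ j, ρ j ^ (2 * b j) := fun b => by
    have : truncTerm N a c (fun j => ((ρ j : ℝ) : ℂ)) n b =
      ((tTrunc N a (blockIndex c b) n * ∏ j, ρ j ^ (2 * b j) : ℝ) : ℂ) := by
      simp [truncTerm]
    rw [this]; rfl
  simp only [hre] at h
  refine (sum_le_hasSum u (fun b _ => mul_nonneg (tTrunc_nonneg _ n)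
    (Finset.prod_nonneg fun j _ => pow_nonneg (h0 j) _)) h).trans ?_
  exact (Complex.re_le_norm _).trans (hM ⟨n, rfl⟩)

lemma exists_tTrunc_le (b : Fin (d + 1) → ℕ) : ∃ M, ∀ n, tTrunc N a (blockIndex c b) n ≤ M := by
  -- Any fixed radius in `(0, 1)` would do; a single `b` is then isolated from the generating
  -- series.
  obtain ⟨M, hM⟩ := exists_sum_tTrunc_le ha haN hc hc1 hd (ρ := fun _ => 1 / 2)
    (fun _ => by norm_num) (fun _ => by norm_num)
  refine ⟨M / ∏ j, (1 / 2) ^ (2 * b j), fun n => ?_⟩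
  rw [le_div_iff₀ (Finset.prod_pos fun j _ => by positivity)]
  simpa using hM {b} n

lemma summable_tStarTerm (b : Fin (d + 1) → ℕ) :
    Summable fun k : {k : Fin (blockIndex c b).length → ℕ // Antitone k} =>
      tStarTerm N a (blockIndex c b) k := by
  obtain ⟨M, hM⟩ := exists_tTrunc_le ha haN hc hc1 hd b
  exact summable_of_sum_antiTuples_le (tStarTerm_nonneg _) fun K =>
    (sum_antiTuples_tStarTerm N a _ K).trans_le (hM K)

lemma tendsto_tTrunc (b : Fin (d + 1) → ℕ) :
    Tendsto (tTrunc N a (blockIndex c b)) atTop (𝓝 (tStar N a (blockIndex c b))) :=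
  (tendsto_sum_antiTuples (summable_tStarTerm ha haN hc hc1 hd b).hasSum).congr fun K =>
    sum_antiTuples_tStarTerm N a _ K

lemma tTrunc_le_tStar (b : Fin (d + 1) → ℕ) (n : ℕ) :
    tTrunc N a (blockIndex c b) n ≤ tStar N a (blockIndex c b) := by
  exact (sum_antiTuples_tStarTerm N a _ n).symm.trans_le
    (sum_antiTuples_le_tsum (tStarTerm_nonneg _) (summable_tStarTerm ha haN hc hc1 hd b) n)

lemma summable_norm_genTerm {z : Fin (d + 1) → ℂ} (hz : ∀ j, ‖z j‖ < 1) :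
    Summable fun b => ‖genTerm N a c z b‖ := by
  obtain ⟨M, hM⟩ := exists_sum_tTrunc_le ha haN hc hc1 hd (fun j => norm_nonneg (z j)) hz
  refine summable_of_sum_le (c := M) (fun _ => norm_nonneg _) fun u => ?_
  have h := le_of_tendsto' (tendsto_finsetSum u fun b _ =>
    (tendsto_tTrunc ha haN hc hc1 hd b).mul_const (∏ j, ‖z j‖ ^ (2 * b j))) (hM u)
  refine le_of_eq_of_le (Finset.sum_congr rfl fun b _ => ?_) h
  have h0 := (tTrunc_nonneg _ 0).trans (tTrunc_le_tStar ha haN hc hc1 hd b 0)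
  rw [genTerm, norm_mul, norm_prod, Complex.norm_real, Real.norm_of_nonneg h0]
  simp only [norm_pow]

/-- Truncations increase to the t-star values, so the terms of `D` themselves dominate. -/
lemma tendsto_finiteSum_genFun {z : Fin (d + 1) → ℂ} (hz : ∀ j, ‖z j‖ < 1) :
    Tendsto (finiteSum N a c z) atTop (𝓝 (genFun N a c z)) := by
  have h := tendsto_tsum_of_dominated_convergence (f := truncTerm N a c z) (𝓕 := atTop)
    (summable_norm_genTerm ha haN hc hc1 hd hz) (g := genTerm N a c z)
    (fun b => ((Complex.continuous_ofReal.tendsto _).comp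
      (tendsto_tTrunc ha haN hc hc1 hd b)).mul_const _)
    (Eventually.of_forall fun n b => by
      rw [truncTerm, genTerm, norm_mul, norm_mul, Complex.norm_real, Complex.norm_real]
      refine mul_le_mul_of_nonneg_right ?_ (norm_nonneg _)
      rw [Real.norm_of_nonneg (tTrunc_nonneg _ n)]
      exact (tTrunc_le_tStar ha haN hc hc1 hd b n).trans (le_abs_self _))
  exact h.congr fun n => (hasSum_truncTerm ha haN hc hz n).tsum_eq

lemma tendsto_sum_tuplesLE {z : Fin (d + 1) → ℂ} (hz : ∀ j, ‖z j‖ < 1) :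
    Tendsto (fun K : ℕ => (N : ℂ) / Complex.betaIntegral ((a : ℂ) / N) ((a : ℂ) / N) *
      ∑ k ∈ tuplesLE d K, summand N a c z k) atTop (𝓝 (genFun N a c z)) := by
  obtain ⟨S, hS⟩ := exists_tendsto_sum_outer ha haN hc hc1 hd hz
  simp only [sum_tuplesLE_summand ha haN, coeffLim_cast ha haN]
  rw [tendsto_nhds_unique (tendsto_finiteSum_genFun ha haN hc hc1 hd hz)
    (tendsto_sum_coeff_mul ha haN hS)]
  exact hS.const_mul _

lemma hasSum_summand (hd1 : 1 ≤ d) {z : Fin (d + 1) → ℂ} (hz : ∀ j, ‖z j‖ < 1) :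
    HasSum (fun k : {k : Fin (d + 1) → ℕ // Antitone k} =>
      (N : ℂ) / Complex.betaIntegral ((a : ℂ) / N) ((a : ℂ) / N) * summand N a c z k)
      (genFun N a c z) := by
  have hs := summable_norm_outerFactor_mul ha haN hd1 hc (hc1 hd1) hz
  have h : Summable fun k : {k : Fin (d + 1) → ℕ // Antitone k} => summand N a c z k := by
    refine Summable.of_norm (summable_of_sum_antiTuples_le (f := fun k => ‖summand N a c z k‖)
      (M := ∑' k, ‖outerFactor N a (z 0) k‖ * absInner N a c z k)
      (fun _ => norm_nonneg _) fun K => ?_)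
    rw [sum_antiTuples_norm_summand ha haN]
    exact hs.sum_le_tsum _ fun k _ =>
      mul_nonneg (norm_nonneg _) (absInner_nonneg ha haN c z k)
  obtain ⟨S, hS⟩ := h.mul_left ((N : ℂ) / Complex.betaIntegral ((a : ℂ) / N) ((a : ℂ) / N))
  have h1 := tendsto_sum_antiTuples (f := fun k =>
    (N : ℂ) / Complex.betaIntegral ((a : ℂ) / N) ((a : ℂ) / N) * summand N a c z k) hS
  have h2 := tendsto_sum_tuplesLE ha haN hc hc1 hd hz
  simp only [Finset.mul_sum, tuplesLE_eq] at h2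
  -- The sets `tuplesLE d K` exhaust the antitone tuples, so the absolutely convergent sum equals
  -- the limit over `K`.
  exact tendsto_nhds_unique h1 h2 ▸ hS

end main

end TStar

theorem mainTheorem3 (N a d : ℕ) (ha : 1 ≤ a) (haN : a ≤ N)
    (c : Fin d → ℕ) (hc : ∀ j, 1 ≤ c j ∧ c j ≠ 2) (hc1 : ∀ h : 0 < d, 3 ≤ c ⟨0, h⟩)
    (z : Fin (d + 1) → ℂ) (hz : ∀ j, ‖z j‖ < 1)
    (hd : 1 ≤ d ∨ a < N) :
    -- the multiple t-star values and the generating function are convergent series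
    (∀ b : Fin (d + 1) → ℕ,
      Summable fun k : {k : Fin (TStar.blockIndex c b).length → ℕ // Antitone k} =>
        TStar.tStarTerm N a (TStar.blockIndex c b) k) ∧
    Summable (TStar.genTerm N a c z) ∧
    -- the nested sum, with `k_0` as the outermost index, converges and gives `D(c; z)`
    Tendsto
      (fun K : ℕ => (N : ℂ) / Complex.betaIntegral ((a : ℂ) / N) ((a : ℂ) / N) *
        ∑ k ∈ TStar.tuplesLE d K, TStar.summand N a c z k)
      atTop (𝓝 (TStar.genFun N a c z)) ∧
    -- for `d ≥ 1` it converges absolutely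
    (1 ≤ d → HasSum
      (fun k : {k : Fin (d + 1) → ℕ // Antitone k} =>
        (N : ℂ) / Complex.betaIntegral ((a : ℂ) / N) ((a : ℂ) / N) * TStar.summand N a c z k)
      (TStar.genFun N a c z)) :=
  ⟨TStar.summable_tStarTerm ha haN hc hc1 hd,
    (TStar.summable_norm_genTerm ha haN hc hc1 hd hz).of_norm,
    TStar.tendsto_sum_tuplesLE ha haN hc hc1 hd hz,
    fun hd1 => TStar.hasSum_summand ha haN hc hc1 hd hd1 hz⟩
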